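/- Let $\mathcal H_{\mathsf A},\mathcal H_{\mathsf B}$ be finite-dimensional complex Hilbert spaces. A positive operator on a bipartite space is separable if it is a finite sum $\sum_i \tau_i\otimes\omega_i$ with $\tau_i,\omega_i\ge 0$; a state (positive operator of trace $1$) is entangled if it is not separable. A completely positive map between operators on bipartite spaces is non-entangling if it maps every separable operator to a separable operator. It is dually non-entangling if both it and its dual $\Lambda^*$, defined by $\operatorname{Tr}(\Lambda(X)Y)=\operatorname{Tr}(X\Lambda^*(Y))$ for all $X,Y$, are non-entangling. Let $\phi_2^+=|\phi_2^+\rangle\langle\phi_2^+|$ with $|\phi_2^+\rangle=(|00\rangle+|11\rangle)/\sqrt2$. A bipartite state $\sigma$ is LOCC-distillable if there are LOCC channels $\Lambda_n$ (local operations and finitely many rounds of classical communication) from $n$ copies to two qubits with $\lim_{n\to\infty}\|\Lambda_n(\sigma^{\otimes n})-\phi_2^+\|_1=0$, where $\|\cdot\|_1$ is the trace norm. An entanglement witness is a Hermitian operator $W$ with $\operatorname{Tr}(W\sigma)\ge0$ for every separable state $\sigma$. **Theorem.** For every entangled state $\rho$ on $\mathcal H_{\mathsf A}\otimes\mathcal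 H_{\mathsf B}$ there is a quantum channel $\Lambda:\mathcal L(\mathcal H_{\mathsf A}\otimes\mathcal H_{\mathsf B})\to\mathcal L(\mathbb C^2\otimes\mathbb C^2)$ such that 1. $\Lambda$ is dually non-entangling; 2. the two-qubit state $\Lambda(\rho)$ satisfies $\operatorname{Tr}(\Lambda(\rho)\,\phi_2^+)>1/2$; 3. $\Lambda(\rho)$ is LOCC-distillable. Moreover, $\Lambda$ can be chosen of the form $$\Lambda(X)=\operatorname{Tr}(AX)\,\tfrac14\mathbf 1_4+\operatorname{Tr}((\mathbf 1-A)X)\,\phi_2^+,\qquad A=\tfrac13(W+2\cdot\mathbf 1),$$ where $W$ is an entanglement witness with Frobenius norm $\|W\|_2\le1$ and $\operatorname{Tr}(W\rho)<0$. -/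

import Mathlib

open scoped Kronecker ComplexOrder

noncomputable section

/-! Operators on a finite-dimensional Hilbert space with orthonormal basis `A` are matrices
`Matrix A A ℂ`; the basis of a bipartite space `A : B` is `A × B`. -/

/-- Density operators. -/
def IsState {A : Type*} [Fintype A] (ρ : Matrix A A ℂ) : Prop :=
  ρ.PosSemidef ∧ ρ.trace = 1

/-- Separable (not necessarily normalised) positive operators with respect to `A : B`. -/
def IsSeparableOperator {A B : Type*} (σ : Matrix (A × B) (A × B) ℂ) : Prop :=
  ∃ (m : ℕ) (τ : Fin m → Matrix A A ℂ) (ω : Fin m → Matrix B B ℂ),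
    (∀ i, (τ i).PosSemidef) ∧ (∀ i, (ω i).PosSemidef) ∧ σ = ∑ i, τ i ⊗ₖ ω i

/-- Entangled states with respect to `A : B`. -/
def IsEntangledState {A B : Type*} [Fintype A] [Fintype B]
    (ρ : Matrix (A × B) (A × B) ℂ) : Prop :=
  IsState ρ ∧ ¬ IsSeparableOperator ρ

/-- Entanglement witnesses with respect to `A : B`
(the trace below is real, as `W` and `σ` are Hermitian). -/
def IsEntanglementWitness {A B : Type*} [Fintype A] [Fintype B]
    (W : Matrix (A × B) (A × B) ℂ) : Prop :=
  W.IsHermitian ∧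
    ∀ σ : Matrix (A × B) (A × B) ℂ, IsState σ → IsSeparableOperator σ → 0 ≤ (W * σ).trace.re

open scoped Matrix.Norms.Frobenius in
/-- The Frobenius norm of a matrix. -/
def frobeniusNorm {A : Type*} [Fintype A] (X : Matrix A A ℂ) : ℝ := ‖X‖

/-- The trace norm: the sum of the singular values. -/
def traceNorm {A : Type*} [Fintype A] [DecidableEq A] (X : Matrix A A ℂ) : ℝ :=
  ∑ i, √((Matrix.isHermitian_conjTranspose_mul_self X).eigenvalues i)

/-- `ampliation k Λ` is `id ⊗ Λ` on `ℂᵏ ⊗ A`: `Λ` is applied to every block. -/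
def ampliation {A A' : Type*} (k : ℕ) (Λ : Matrix A A ℂ →ₗ[ℂ] Matrix A' A' ℂ)
    (M : Matrix (Fin k × A) (Fin k × A) ℂ) : Matrix (Fin k × A') (Fin k × A') ℂ :=
  Matrix.of fun p q => Λ (Matrix.of fun x y => M (p.1, x) (q.1, y)) p.2 q.2

/-- Complete positivity: every ampliation preserves positive semidefiniteness. -/
def IsCompletelyPositive {A A' : Type*} (Λ : Matrix A A ℂ →ₗ[ℂ] Matrix A' A' ℂ) : Prop :=
  ∀ (k : ℕ) (M : Matrix (Fin k × A) (Fin k × A) ℂ),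
    M.PosSemidef → (ampliation k Λ M).PosSemidef

/-- Trace preservation. -/
def IsTracePreserving {A A' : Type*} [Fintype A] [Fintype A']
    (Λ : Matrix A A ℂ →ₗ[ℂ] Matrix A' A' ℂ) : Prop :=
  ∀ X, (Λ X).trace = X.trace

/-- Quantum channels (CPTP maps). -/
def IsQuantumChannel {A A' : Type*} [Fintype A] [Fintype A']
    (Λ : Matrix A A ℂ →ₗ[ℂ] Matrix A' A' ℂ) : Prop :=
  IsCompletelyPositive Λ ∧ IsTracePreserving Λ

/-- The dual map `Λ*`, characterised by `Tr(Λ(X) Y) = Tr(X Λ*(Y))`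
(see `trace_map_mul` and `eq_dualMap`). -/
def dualMap {A A' : Type*} [Fintype A'] [DecidableEq A]
    (Λ : Matrix A A ℂ →ₗ[ℂ] Matrix A' A' ℂ) : Matrix A' A' ℂ →ₗ[ℂ] Matrix A A ℂ where
  toFun Y := Matrix.of fun i j => (Λ (Matrix.single j i 1) * Y).trace
  map_add' Y Z := by
    ext i j
    simp [mul_add]
  map_smul' c Y := by
    ext i j
    simp

theorem trace_map_mul {A A' : Type*} [Fintype A] [Fintype A'] [DecidableEq A]
    (Λ : Matrix A A ℂ →ₗ[ℂ] Matrix A' A' ℂ) (X : Matrix A A ℂ) (Y : Matrix A' A' ℂ) :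
    (Λ X * Y).trace = (X * dualMap Λ Y).trace := by
  have hX : Λ X = ∑ i, ∑ j, X i j • Λ (Matrix.single i j 1) := by
    conv_lhs => rw [Matrix.matrix_eq_sum_single X]
    simp only [map_sum]
    refine Finset.sum_congr rfl fun i _ => Finset.sum_congr rfl fun j _ => ?_
    rw [← map_smul, Matrix.smul_single, smul_eq_mul, mul_one]
  rw [hX, Finset.sum_mul, Matrix.trace_sum]
  conv_rhs => rw [Matrix.trace]
  refine Finset.sum_congr rfl fun i _ => ?_
  rw [Finset.sum_mul, Matrix.trace_sum, Matrix.diag_apply, Matrix.mul_apply]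
  refine Finset.sum_congr rfl fun j _ => ?_
  rw [Matrix.smul_mul, Matrix.trace_smul, smul_eq_mul]
  rfl

theorem eq_dualMap {A A' : Type*} [Fintype A] [Fintype A'] [DecidableEq A]
    (Λ : Matrix A A ℂ →ₗ[ℂ] Matrix A' A' ℂ) (Θ : Matrix A' A' ℂ →ₗ[ℂ] Matrix A A ℂ)
    (h : ∀ X Y, (Λ X * Y).trace = (X * Θ Y).trace) : Θ = dualMap Λ := by
  refine LinearMap.ext fun Y => Matrix.ext_iff_trace_mul_left.mpr fun X => ?_
  rw [← h, trace_map_mul]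

/-- Non-entangling (separable-preserving) maps. -/
def IsNonEntangling {A₁ B₁ A₂ B₂ : Type*}
    (Λ : Matrix (A₁ × B₁) (A₁ × B₁) ℂ →ₗ[ℂ] Matrix (A₂ × B₂) (A₂ × B₂) ℂ) : Prop :=
  IsCompletelyPositive Λ ∧ ∀ σ, IsSeparableOperator σ → IsSeparableOperator (Λ σ)

/-- Dually non-entangling maps. -/
def IsDuallyNonEntangling {A₁ B₁ A₂ B₂ : Type*} [Fintype A₂] [Fintype B₂]
    [DecidableEq A₁] [DecidableEq B₁]
    (Λ : Matrix (A₁ × B₁) (A₁ × B₁) ℂ →ₗ[ℂ] Matrix (A₂ × B₂) (A₂ × B₂) ℂ) : Prop :=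
  IsNonEntangling Λ ∧ IsNonEntangling (dualMap Λ)

/-- `Λ = ∑ j, Φ j ⊗ Ψ j`, tested on product operators, which span all operators. -/
def IsSumOfTensors {A₁ B₁ A₂ B₂ : Type*} {m : ℕ}
    (Λ : Matrix (A₁ × B₁) (A₁ × B₁) ℂ →ₗ[ℂ] Matrix (A₂ × B₂) (A₂ × B₂) ℂ)
    (Φ : Fin m → Matrix A₁ A₁ ℂ →ₗ[ℂ] Matrix A₂ A₂ ℂ)
    (Ψ : Fin m → Matrix B₁ B₁ ℂ →ₗ[ℂ] Matrix B₂ B₂ ℂ) : Prop :=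
  ∀ X Y, Λ (X ⊗ₖ Y) = ∑ j, Φ j X ⊗ₖ Ψ j Y

/-- One-way LOCC channels, communication from `A` to `B`: the first party applies an instrument
`(Φ j)` and announces the outcome `j`; the second party then applies the channel `Ψ j`. -/
def IsOneWayRight {A₁ B₁ A₂ B₂ : Type*} [Fintype A₁] [Fintype B₁] [Fintype A₂] [Fintype B₂]
    (Λ : Matrix (A₁ × B₁) (A₁ × B₁) ℂ →ₗ[ℂ] Matrix (A₂ × B₂) (A₂ × B₂) ℂ) : Prop :=
  ∃ (m : ℕ) (Φ : Fin m → Matrix A₁ A₁ ℂ →ₗ[ℂ] Matrix A₂ A₂ ℂ)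
    (Ψ : Fin m → Matrix B₁ B₁ ℂ →ₗ[ℂ] Matrix B₂ B₂ ℂ),
    (∀ j, IsCompletelyPositive (Φ j)) ∧ IsTracePreserving (∑ j, Φ j) ∧
      (∀ j, IsQuantumChannel (Ψ j)) ∧ IsSumOfTensors Λ Φ Ψ

/-- One-way LOCC channels, communication from `B` to `A`. -/
def IsOneWayLeft {A₁ B₁ A₂ B₂ : Type*} [Fintype A₁] [Fintype B₁] [Fintype A₂] [Fintype B₂]
    (Λ : Matrix (A₁ × B₁) (A₁ × B₁) ℂ →ₗ[ℂ] Matrix (A₂ × B₂) (A₂ × B₂) ℂ) : Prop :=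
  ∃ (m : ℕ) (Φ : Fin m → Matrix A₁ A₁ ℂ →ₗ[ℂ] Matrix A₂ A₂ ℂ)
    (Ψ : Fin m → Matrix B₁ B₁ ℂ →ₗ[ℂ] Matrix B₂ B₂ ℂ),
    (∀ j, IsQuantumChannel (Φ j)) ∧ (∀ j, IsCompletelyPositive (Ψ j)) ∧
      IsTracePreserving (∑ j, Ψ j) ∧ IsSumOfTensors Λ Φ Ψ

/-- LOCC channels: finite compositions of one-way LOCC channels (in either direction), through
arbitrary finite-dimensional intermediate local spaces. These are the channels implemented by
finitely many rounds of local operations and classical communication; memory of earlier outcomes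
is kept in the intermediate local spaces. -/
inductive IsLOCC : {A₁ B₁ A₂ B₂ : Type} → [Fintype A₁] → [Fintype B₁] → [Fintype A₂] →
    [Fintype B₂] →
    (Matrix (A₁ × B₁) (A₁ × B₁) ℂ →ₗ[ℂ] Matrix (A₂ × B₂) (A₂ × B₂) ℂ) → Prop
  | right {A₁ B₁ A₂ B₂ : Type} [Fintype A₁] [Fintype B₁] [Fintype A₂] [Fintype B₂]
      {Λ : Matrix (A₁ × B₁) (A₁ × B₁) ℂ →ₗ[ℂ] Matrix (A₂ × B₂) (A₂ × B₂) ℂ} :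
      IsOneWayRight Λ → IsLOCC Λ
  | left {A₁ B₁ A₂ B₂ : Type} [Fintype A₁] [Fintype B₁] [Fintype A₂] [Fintype B₂]
      {Λ : Matrix (A₁ × B₁) (A₁ × B₁) ℂ →ₗ[ℂ] Matrix (A₂ × B₂) (A₂ × B₂) ℂ} :
      IsOneWayLeft Λ → IsLOCC Λ
  | comp {A₁ B₁ A₂ B₂ A₃ B₃ : Type} [Fintype A₁] [Fintype B₁] [Fintype A₂] [Fintype B₂]
      [Fintype A₃] [Fintype B₃]
      {Λ : Matrix (A₁ × B₁) (A₁ × B₁) ℂ →ₗ[ℂ] Matrix (A₂ × B₂) (A₂ × B₂) ℂ}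
      {Θ : Matrix (A₂ × B₂) (A₂ × B₂) ℂ →ₗ[ℂ] Matrix (A₃ × B₃) (A₃ × B₃) ℂ} :
      IsLOCC Λ → IsLOCC Θ → IsLOCC (Θ ∘ₗ Λ)

/-- `ρ^{⊗ n}`, regarded as an operator on the bipartite space `A^{⊗ n} : B^{⊗ n}`. -/
def tensorPower {A B : Type*} (ρ : Matrix (A × B) (A × B) ℂ) (n : ℕ) :
    Matrix ((Fin n → A) × (Fin n → B)) ((Fin n → A) × (Fin n → B)) ℂ :=
  Matrix.of fun p q => ∏ i, ρ (p.1 i, p.2 i) (q.1 i, q.2 i)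

/-- The two-qubit unit vector `(|00⟩ + |11⟩) / √2`. -/
def phiPlusVec : Fin 2 × Fin 2 → ℂ := fun p => if p.1 = p.2 then ((√2 : ℝ) : ℂ)⁻¹ else 0

/-- The maximally entangled two-qubit state `φ₂⁺`. -/
def phiPlus : Matrix (Fin 2 × Fin 2) (Fin 2 × Fin 2) ℂ :=
  Matrix.vecMulVec phiPlusVec (star phiPlusVec)

/-- Distillability under LOCC: LOCC channels `Λₙ` with `‖Λₙ(ρ^{⊗ n}) - φ₂⁺‖₁ → 0` exist. -/
def IsLOCCDistillable {A B : Type} [Fintype A] [Fintype B] (ρ : Matrix (A × B) (A × B) ℂ) :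
    Prop :=
  ∃ Λ : ∀ n : ℕ,
      Matrix ((Fin n → A) × (Fin n → B)) ((Fin n → A) × (Fin n → B)) ℂ →ₗ[ℂ]
        Matrix (Fin 2 × Fin 2) (Fin 2 × Fin 2) ℂ,
    (∀ n, IsLOCC (Λ n)) ∧
    Filter.Tendsto (fun n => traceNorm (Λ n (tensorPower ρ n) - phiPlus)) Filter.atTop (nhds 0)

end

/-!
A Hahn–Banach functional separates `ρ` from the separable operators, and `1` is interior to the
separable cone, so it can be scaled to a witness `W` with `‖W‖₂ ≤ 1` and `1 ± W` separable. Then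
`1 + 2 φ₂⁺` being separable and `1 - 2 φ₂⁺` being nonnegative on separable operators make the
measure-and-prepare map of `W` and its dual non-entangling. Its value at `ρ` is diagonal in the
Bell basis and has fidelity `1 / 2 - Tr(W ρ) / 4 > 1 / 2` with `φ₂⁺`.

To distill such a state, both parties project onto a repetition code in the computational basis,
and then onto one in the conjugate basis. The first projection suppresses bit flips at the price of
amplifying phase flips, the second suppresses phase flips; with suitable code lengths a success
leaves a state arbitrarily close to `φ₂⁺`. Applied to many independent blocks, the projections
succeed on at least one with probability tending to `1`, and the parties keep the first block on
which they did.
-/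

noncomputable section

open scoped Matrix

/-! ### Kraus families -/

section Kraus

variable {ι κ A B C D : Type*}

theorem sum_kronecker {R : Type*} [CommSemiring R] (s : Finset ι) (X : ι → Matrix C A R)
    (Y : Matrix D B R) : (∑ i ∈ s, X i) ⊗ₖ Y = ∑ i ∈ s, X i ⊗ₖ Y :=
  LinearMap.map_sum₂ (Matrix.kroneckerBilinear (R := R)) s X Y

theorem kronecker_sum {R : Type*} [CommSemiring R] (s : Finset ι) (X : Matrix C A R)
    (Y : ι → Matrix D B R) : X ⊗ₖ (∑ i ∈ s, Y i) = ∑ i ∈ s, X ⊗ₖ Y i :=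
  map_sum (Matrix.kroneckerBilinear (R := R) X) Y s

/-- The completely positive map with Kraus operators `K i`. -/
def krausMap [Fintype ι] [Fintype A] (K : ι → Matrix C A ℂ) :
    Matrix A A ℂ →ₗ[ℂ] Matrix C C ℂ where
  toFun X := ∑ i, K i * X * (K i)ᴴ
  map_add' X Y := by simp [Matrix.mul_add, Matrix.add_mul, Finset.sum_add_distrib]
  map_smul' c X := by simp [Finset.smul_sum]

theorem krausMap_apply [Fintype ι] [Fintype A] (K : ι → Matrix C A ℂ) (X : Matrix A A ℂ) :
    krausMap K X = ∑ i, K i * X * (K i)ᴴ := rfl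

theorem posSemidef_krausMap [Fintype ι] [Fintype A] [Finite C] (K : ι → Matrix C A ℂ)
    {X : Matrix A A ℂ} (hX : X.PosSemidef) : (krausMap K X).PosSemidef :=
  Matrix.posSemidef_sum _ fun i _ => hX.mul_mul_conjTranspose_same (K i)

theorem ampliation_krausMap [Fintype ι] [Fintype A] (K : ι → Matrix C A ℂ) (k : ℕ) :
    ampliation k (krausMap K) = krausMap fun i => (1 : Matrix (Fin k) (Fin k) ℂ) ⊗ₖ K i := by
  ext M ⟨i, c⟩ ⟨j, d⟩
  simp [ampliation, krausMap_apply, Matrix.sum_apply, Matrix.mul_apply, Fintype.sum_prod_type,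
    Matrix.one_apply, Finset.sum_mul, apply_ite (starRingEnd ℂ)]

theorem isCompletelyPositive_krausMap [Fintype ι] [Fintype A] [Finite C] (K : ι → Matrix C A ℂ) :
    IsCompletelyPositive (krausMap K) := fun k M hM => by
  rw [ampliation_krausMap]
  exact posSemidef_krausMap _ hM

/-- The Kraus operators of a trace-preserving map. -/
def IsKrausFamily [Fintype ι] [DecidableEq A] [Fintype C] (K : ι → Matrix C A ℂ) : Prop :=
  ∑ i, (K i)ᴴ * K i = 1

namespace IsKrausFamily

variable [Fintype ι] [Fintype A] [DecidableEq A] [Fintype C] {K : ι → Matrix C A ℂ}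

theorem isTracePreserving (hK : IsKrausFamily K) : IsTracePreserving (krausMap K) := fun X =>
  calc (krausMap K X).trace
      = ∑ i, (K i * X * (K i)ᴴ).trace := by rw [krausMap_apply, Matrix.trace_sum]
    _ = ∑ i, ((K i)ᴴ * K i * X).trace :=
        Finset.sum_congr rfl fun i _ => by rw [Matrix.trace_mul_comm, Matrix.mul_assoc]
    _ = X.trace := by rw [← Matrix.trace_sum, ← Finset.sum_mul, hK, one_mul]

theorem isQuantumChannel (hK : IsKrausFamily K) : IsQuantumChannel (krausMap K) :=
  ⟨isCompletelyPositive_krausMap K, hK.isTracePreserving⟩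

theorem isTracePreserving_sum (hK : IsKrausFamily K) :
    IsTracePreserving (∑ j : Fin (Fintype.card ι),
      krausMap fun _ : Unit => K ((Fintype.equivFin ι).symm j)) := by
  have h : ∑ j, krausMap (fun _ : Unit => K ((Fintype.equivFin ι).symm j)) = krausMap K := by
    ext1 X
    rw [(Fintype.equivFin ι).symm.sum_comp fun i => krausMap fun _ : Unit => K i]
    simp [krausMap_apply]
  rw [h]
  exact hK.isTracePreserving

theorem isState (hK : IsKrausFamily K) {X : Matrix A A ℂ} (hX : IsState X) :
    IsState (krausMap K X) :=
  ⟨posSemidef_krausMap K hX.1, (hK.isTracePreserving X).trans hX.2⟩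

end IsKrausFamily

theorem IsKrausFamily.kronecker [Fintype ι] [Fintype κ] [Fintype C] [Fintype D] [DecidableEq A]
    [DecidableEq B] {K : ι → Matrix C A ℂ} {L : κ → Matrix D B ℂ} (hK : IsKrausFamily K)
    (hL : IsKrausFamily L) : IsKrausFamily fun p : ι × κ => K p.1 ⊗ₖ L p.2 := by
  simp only [IsKrausFamily] at hK hL ⊢
  simp only [Matrix.conjTranspose_kronecker, ← Matrix.mul_kronecker_mul, Fintype.sum_prod_type,
    ← kronecker_sum, ← sum_kronecker, hK, hL, Matrix.one_kronecker_one]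

theorem krausMap_comp [Fintype ι] [Fintype κ] [Fintype A] [Fintype C] (L : κ → Matrix D C ℂ)
    (K : ι → Matrix C A ℂ) :
    krausMap L ∘ₗ krausMap K = krausMap fun p : κ × ι => L p.1 * K p.2 := by
  ext1 X
  simp only [LinearMap.comp_apply, krausMap_apply, Fintype.sum_prod_type, Matrix.mul_sum,
    Matrix.sum_mul, Matrix.conjTranspose_mul, Matrix.mul_assoc]

theorem krausMap_kronecker_right [Fintype ι] [Fintype κ] [Fintype A] [Fintype B]
    (K : ι → Matrix C A ℂ) (L : ι → κ → Matrix D B ℂ) (X : Matrix A A ℂ) (Y : Matrix B B ℂ) :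
    krausMap (fun p : ι × κ => K p.1 ⊗ₖ L p.1 p.2) (X ⊗ₖ Y) =
      ∑ i, krausMap (fun _ : Unit => K i) X ⊗ₖ krausMap (L i) Y := by
  simp only [krausMap_apply, Fintype.sum_prod_type, Matrix.conjTranspose_kronecker,
    ← Matrix.mul_kronecker_mul, kronecker_sum, Finset.univ_unique, Finset.sum_singleton]

theorem krausMap_kronecker_left [Fintype ι] [Fintype κ] [Fintype A] [Fintype B]
    (K : ι → κ → Matrix C A ℂ) (L : ι → Matrix D B ℂ) (X : Matrix A A ℂ) (Y : Matrix B B ℂ) :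
    krausMap (fun p : ι × κ => K p.1 p.2 ⊗ₖ L p.1) (X ⊗ₖ Y) =
      ∑ i, krausMap (K i) X ⊗ₖ krausMap (fun _ : Unit => L i) Y := by
  simp only [krausMap_apply, Fintype.sum_prod_type, Matrix.conjTranspose_kronecker,
    ← Matrix.mul_kronecker_mul, sum_kronecker, Finset.univ_unique, Finset.sum_singleton]

end Kraus

section LOCC

variable {ι κ : Type*} [Fintype ι] [Fintype κ] {A B C D : Type} [Fintype A] [Fintype B] [Fintype C]
  [Fintype D] [DecidableEq A] [DecidableEq B]

theorem isLOCC_krausMap_right {K : ι → Matrix C A ℂ} {L : ι → κ → Matrix D B ℂ}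
    (hK : IsKrausFamily K) (hL : ∀ i, IsKrausFamily (L i)) :
    IsLOCC (krausMap fun p : ι × κ => K p.1 ⊗ₖ L p.1 p.2) := by
  refine .right ⟨Fintype.card ι,
    fun j => krausMap fun _ : Unit => K ((Fintype.equivFin ι).symm j),
    fun j => krausMap (L ((Fintype.equivFin ι).symm j)),
    fun j => isCompletelyPositive_krausMap _, hK.isTracePreserving_sum,
    fun j => (hL _).isQuantumChannel, fun X Y => ?_⟩
  rw [krausMap_kronecker_right, ← (Fintype.equivFin ι).symm.sum_comp]

theorem isLOCC_krausMap_left {K : ι → κ → Matrix C A ℂ} {L : ι → Matrix D B ℂ}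
    (hK : ∀ i, IsKrausFamily (K i)) (hL : IsKrausFamily L) :
    IsLOCC (krausMap fun p : ι × κ => K p.1 p.2 ⊗ₖ L p.1) := by
  refine .left ⟨Fintype.card ι,
    fun j => krausMap (K ((Fintype.equivFin ι).symm j)),
    fun j => krausMap fun _ : Unit => L ((Fintype.equivFin ι).symm j),
    fun j => (hK _).isQuantumChannel, fun j => isCompletelyPositive_krausMap _,
    hL.isTracePreserving_sum, fun X Y => ?_⟩
  rw [krausMap_kronecker_left, ← (Fintype.equivFin ι).symm.sum_comp]

end LOCC

/-! ### Sesquilinear forms -/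

/-- The sesquilinear form `⟨u, X v⟩`; the fidelity of `X` with a unit vector `w` is
`sesqForm X w w`. -/
def sesqForm {A : Type*} [Fintype A] (X : Matrix A A ℂ) (u v : A → ℂ) : ℂ :=
  star u ⬝ᵥ X *ᵥ v

section SesqForm

variable {ι κ A C : Type*} [Fintype A]

theorem sesqForm_eq_sum (X : Matrix A A ℂ) (u v : A → ℂ) :
    sesqForm X u v = ∑ p, ∑ q, star (u p) * X p q * v q := by
  simp [sesqForm, dotProduct, Matrix.mulVec, Finset.mul_sum, mul_assoc]

theorem sesqForm_single [DecidableEq A] (X : Matrix A A ℂ) (a b : A) :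
    sesqForm X (Pi.single a 1) (Pi.single b 1) = X a b := by
  simp [sesqForm]

theorem sesqForm_self_nonneg {X : Matrix A A ℂ} (hX : X.PosSemidef) (v : A → ℂ) :
    0 ≤ sesqForm X v v :=
  hX.dotProduct_mulVec_nonneg v

theorem mul_mul_conjTranspose_apply (K : Matrix C A ℂ) (X : Matrix A A ℂ) (c d : C) :
    (K * X * Kᴴ) c d = sesqForm X (star (K c)) (star (K d)) := by
  rw [sesqForm_eq_sum, Matrix.mul_apply]
  simp only [Matrix.mul_apply, Finset.sum_mul, Matrix.conjTranspose_apply, Pi.star_apply, star_star]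
  exact Finset.sum_comm

theorem sesqForm_krausMap [Fintype ι] [Fintype C] (K : ι → Matrix C A ℂ) (X : Matrix A A ℂ)
    (u v : C → ℂ) :
    sesqForm (krausMap K X) u v = ∑ i, sesqForm X ((K i)ᴴ *ᵥ u) ((K i)ᴴ *ᵥ v) := by
  simp only [sesqForm, krausMap_apply, Matrix.sum_mulVec, dotProduct_sum]
  refine Finset.sum_congr rfl fun i _ => ?_
  rw [← Matrix.mulVec_mulVec, ← Matrix.mulVec_mulVec, Matrix.star_mulVec,
    Matrix.conjTranspose_conjTranspose, Matrix.dotProduct_mulVec]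

theorem sum_sesqForm_le_sesqForm_krausMap [Fintype ι] [Fintype κ] [Fintype C]
    (K : ι → Matrix C A ℂ) {X : Matrix A A ℂ} (hX : X.PosSemidef) (w : C → ℂ) {e : κ → ι}
    (he : Function.Injective e) :
    ∑ k, sesqForm X ((K (e k))ᴴ *ᵥ w) ((K (e k))ᴴ *ᵥ w) ≤ sesqForm (krausMap K X) w w := by
  rw [sesqForm_krausMap]
  refine (Finset.sum_map Finset.univ ⟨e, he⟩ fun i =>
    sesqForm X ((K i)ᴴ *ᵥ w) ((K i)ᴴ *ᵥ w)).symm.trans_le ?_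
  exact Finset.sum_le_sum_of_subset_of_nonneg (Finset.subset_univ _)
    fun i _ _ => sesqForm_self_nonneg hX _

end SesqForm

/-! ### Relabelling basis vectors -/

section Relabel

variable {A B C D R S : Type*}

/-- The Kraus operators of the isometry `|a⟩ ↦ |F a⟩` followed by the partial trace over `R`. -/
def relabelKraus [DecidableEq C] [DecidableEq R] (F : A → C × R) (r : R) : Matrix C A ℂ :=
  Matrix.of fun c a => if F a = (c, r) then 1 else 0

theorem isKrausFamily_relabelKraus [DecidableEq C] [DecidableEq R] [Fintype C] [Fintype R]
    [DecidableEq A] {F : A → C × R} (hF : Function.Injective F) :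
    IsKrausFamily (relabelKraus F) := by
  ext a b
  simp only [Matrix.sum_apply, Matrix.mul_apply, Matrix.conjTranspose_apply, relabelKraus,
    Matrix.of_apply, apply_ite star, star_one, star_zero, ite_mul, one_mul, zero_mul,
    Matrix.one_apply]
  rw [Finset.sum_comm, ← Fintype.sum_prod_type' (f := fun c r =>
    if F a = (c, r) then (if F b = (c, r) then (1 : ℂ) else 0) else 0)]
  simp [hF.eq_iff, eq_comm]

theorem conjTranspose_relabelKraus_mulVec [DecidableEq C] [DecidableEq R] [Fintype C]
    (F : A → C × R) (r : R) (w : C → ℂ) (a : A) :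
    ((relabelKraus F r)ᴴ *ᵥ w) a = if (F a).2 = r then w (F a).1 else 0 := by
  rcases hFa : F a with ⟨c, r'⟩
  have hsum : ((relabelKraus F r)ᴴ *ᵥ w) a =
      ∑ d, if c = d then (if r' = r then w d else 0) else 0 :=
    Finset.sum_congr rfl fun d _ => by
      simp only [relabelKraus, Matrix.conjTranspose_apply, Matrix.of_apply, hFa, Prod.mk.injEq]
      split_ifs <;> simp_all
  rw [hsum, Finset.sum_ite_eq, if_pos (Finset.mem_univ c)]

theorem krausMap_relabelKraus_equiv [DecidableEq C] [DecidableEq R] [Fintype A] [Fintype R]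
    (F : A ≃ C × R) (X : Matrix A A ℂ) (c d : C) :
    krausMap (relabelKraus F) X c d = ∑ r, X (F.symm (c, r)) (F.symm (d, r)) := by
  classical
  have hrow : ∀ c r, star (relabelKraus F r c) = Pi.single (F.symm (c, r)) 1 := fun c r => by
    ext a
    simp [relabelKraus, Pi.single_apply, Equiv.eq_symm_apply, apply_ite (starRingEnd ℂ)]
  simp only [krausMap_apply, Matrix.sum_apply, mul_mul_conjTranspose_apply, hrow, sesqForm_single]

/-- Relabelling by `G` after relabelling by `F`. -/
def relabelComp (G : C → D × S) (F : A → C × R) (a : A) : D × (S × R) :=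
  ((G (F a).1).1, ((G (F a).1).2, (F a).2))

theorem krausMap_relabelKraus_comp [DecidableEq C] [DecidableEq D] [DecidableEq R] [DecidableEq S]
    [Fintype A] [Fintype C] [Fintype R] [Fintype S] (G : C → D × S) (F : A → C × R) :
    krausMap (relabelKraus G) ∘ₗ krausMap (relabelKraus F) =
      krausMap (relabelKraus (relabelComp G F)) := by
  rw [krausMap_comp]
  congr 1
  ext ⟨s, r⟩ d a
  simp only [relabelKraus, Matrix.mul_apply, Matrix.of_apply, ite_zero_mul_ite_zero, mul_one]
  rw [Finset.sum_eq_single (F a).1]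
  · exact if_congr (by simp [relabelComp, Prod.ext_iff, and_assoc]) rfl rfl
  · exact fun c _ hc => if_neg fun h => hc (congrArg Prod.fst h.2).symm
  · exact fun h => absurd (Finset.mem_univ _) h

/-- The relabelling in which the first party announces the label `(F a).2`, on which the
relabelling of the second party may depend. -/
def relabelRight (F : A → C × R) (G : R → B → D × S) (p : A × B) : (C × D) × (R × S) :=
  (((F p.1).1, (G (F p.1).2 p.2).1), ((F p.1).2, (G (F p.1).2 p.2).2))

/-- The relabelling in which the second party announces the label `(G b).2`, on which the
relabelling of the first party may depend. -/
def relabelLeft (F : S → A → C × R) (G : B → D × S) (p : A × B) : (C × D) × (S × R) :=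
  (((F (G p.2).2 p.1).1, (G p.2).1), ((G p.2).2, (F (G p.2).2 p.1).2))

theorem relabelKraus_relabelRight [DecidableEq C] [DecidableEq D] [DecidableEq R] [DecidableEq S]
    (F : A → C × R) (G : R → B → D × S) :
    relabelKraus (relabelRight F G) =
      fun p : R × S => relabelKraus F p.1 ⊗ₖ relabelKraus (G p.1) p.2 := by
  ext ⟨r, s⟩ ⟨c, d⟩ ⟨a, b⟩
  simp only [relabelKraus, Matrix.kroneckerMap_apply, Matrix.of_apply, ite_zero_mul_ite_zero,
    mul_one]
  refine if_congr ?_ rfl rfl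
  simp only [relabelRight, Prod.ext_iff]
  constructor <;> rintro ⟨⟨_, _⟩, _, _⟩ <;> simp_all

theorem relabelKraus_relabelLeft [DecidableEq C] [DecidableEq D] [DecidableEq R] [DecidableEq S]
    (F : S → A → C × R) (G : B → D × S) :
    relabelKraus (relabelLeft F G) =
      fun p : S × R => relabelKraus (F p.1) p.2 ⊗ₖ relabelKraus G p.1 := by
  ext ⟨s, r⟩ ⟨c, d⟩ ⟨a, b⟩
  simp only [relabelKraus, Matrix.kroneckerMap_apply, Matrix.of_apply, ite_zero_mul_ite_zero,
    mul_one]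
  refine if_congr ?_ rfl rfl
  simp only [relabelLeft, Prod.ext_iff]
  constructor <;> rintro ⟨⟨_, _⟩, _, _⟩ <;> simp_all

end Relabel

section RelabelLOCC

variable {A B C D : Type} {R S : Type*} [Fintype A] [Fintype B] [Fintype C] [Fintype D] [Fintype R]
  [Fintype S] [DecidableEq C] [DecidableEq D] [DecidableEq R] [DecidableEq S]

theorem isLOCC_relabelRight {F : A → C × R} {G : R → B → D × S} (hF : Function.Injective F)
    (hG : ∀ r, Function.Injective (G r)) : IsLOCC (krausMap (relabelKraus (relabelRight F G))) := by
  classical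
  rw [relabelKraus_relabelRight]
  exact isLOCC_krausMap_right (L := fun r => relabelKraus (G r)) (isKrausFamily_relabelKraus hF)
    fun r => isKrausFamily_relabelKraus (hG r)

theorem isLOCC_relabelLeft {F : S → A → C × R} {G : B → D × S}
    (hF : ∀ s, Function.Injective (F s)) (hG : Function.Injective G) :
    IsLOCC (krausMap (relabelKraus (relabelLeft F G))) := by
  classical
  rw [relabelKraus_relabelLeft]
  exact isLOCC_krausMap_left (K := fun s => relabelKraus (F s))
    (fun s => isKrausFamily_relabelKraus (hF s)) (isKrausFamily_relabelKraus hG)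

end RelabelLOCC

/-! ### Tensor powers -/

/-- `ρ^{⊗ ι}` for a finite index type `ι`, as an operator on `A^{⊗ ι} : B^{⊗ ι}`; the copies are
indexed by an arbitrary type so that they can be grouped into blocks. -/
def tensorPow (ι : Type*) [Fintype ι] {A B : Type*} (ρ : Matrix (A × B) (A × B) ℂ) :
    Matrix ((ι → A) × (ι → B)) ((ι → A) × (ι → B)) ℂ :=
  Matrix.of fun p q => ∏ i, ρ (p.1 i, p.2 i) (q.1 i, q.2 i)

/-- The product vector with factors `v i`, on the same space as `tensorPow`. -/
def prodVec {ι : Type*} [Fintype ι] {A B : Type*} (v : ι → A × B → ℂ) : (ι → A) × (ι → B) → ℂ :=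
  fun p => ∏ i, v i (p.1 i, p.2 i)

/-- The tensor power of a Kraus family. -/
def tensorKraus (ι : Type*) [Fintype ι] {Z A C : Type*} (K : Z → Matrix C A ℂ) (z : ι → Z) :
    Matrix (ι → C) (ι → A) ℂ :=
  Matrix.of fun c a => ∏ i, K (z i) (c i) (a i)

section TensorPow

variable {ι A B C D Y Z : Type*} [Fintype ι] [DecidableEq ι]

theorem sum_prod_arrow [Fintype A] [Fintype B] (f : ι → A × B → ℂ) :
    ∑ p : (ι → A) × (ι → B), ∏ i, f i (p.1 i, p.2 i) = ∏ i, ∑ q, f i q := by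
  rw [Finset.prod_univ_sum, Fintype.piFinset_univ]
  exact (Equiv.sum_comp (Equiv.arrowProdEquivProdArrow ι (fun _ => A) (fun _ => B)).symm
    fun u => ∏ i, f i (u i))

theorem sesqForm_tensorPow [Fintype A] [Fintype B] (ρ : Matrix (A × B) (A × B) ℂ)
    (u v : ι → A × B → ℂ) :
    sesqForm (tensorPow ι ρ) (prodVec u) (prodVec v) = ∏ i, sesqForm ρ (u i) (v i) := by
  simp only [sesqForm_eq_sum, prodVec, tensorPow, Matrix.of_apply, star_prod,
    ← Finset.prod_mul_distrib]
  rw [← sum_prod_arrow fun i p => ∑ q, star (u i p) * ρ p q * v i q]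
  exact Finset.sum_congr rfl fun p _ =>
    sum_prod_arrow fun i q => star (u i (p.1 i, p.2 i)) * ρ (p.1 i, p.2 i) q * v i q

theorem trace_tensorPow [Fintype A] [Fintype B] (ρ : Matrix (A × B) (A × B) ℂ) :
    (tensorPow ι ρ).trace = ρ.trace ^ Fintype.card ι := by
  simp only [Matrix.trace, Matrix.diag_apply, tensorPow, Matrix.of_apply]
  rw [sum_prod_arrow fun _ q => ρ q q, Finset.prod_const, Finset.card_univ]

theorem isKrausFamily_tensorKraus [Fintype Z] [DecidableEq A] [Fintype C] {K : Z → Matrix C A ℂ}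
    (hK : IsKrausFamily K) : IsKrausFamily (tensorKraus ι K) := by
  ext a b
  have hK_apply : ∀ i, ∑ q : Z × C, star (K q.1 q.2 (a i)) * K q.1 q.2 (b i) =
      (1 : Matrix A A ℂ) (a i) (b i) := fun i => by
    rw [← hK, Fintype.sum_prod_type]
    simp [Matrix.sum_apply, Matrix.mul_apply]
  have hprod := sum_prod_arrow fun i (q : Z × C) => star (K q.1 q.2 (a i)) * K q.1 q.2 (b i)
  rw [Fintype.sum_prod_type] at hprod
  simp only [Matrix.sum_apply, Matrix.mul_apply, Matrix.conjTranspose_apply, tensorKraus,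
    Matrix.of_apply, star_prod, ← Finset.prod_mul_distrib, hprod, hK_apply, Matrix.one_apply,
    Finset.prod_ite_zero, Finset.prod_const_one, funext_iff, Finset.mem_univ, true_implies]

theorem krausMap_tensorPow [Fintype Y] [Fintype Z] [Fintype A] [Fintype B] (K : Y → Matrix C A ℂ)
    (L : Z → Matrix D B ℂ) (ρ : Matrix (A × B) (A × B) ℂ) :
    krausMap (fun z : (ι → Y) × (ι → Z) => tensorKraus ι K z.1 ⊗ₖ tensorKraus ι L z.2)
      (tensorPow ι ρ) = tensorPow ι (krausMap (fun z : Y × Z => K z.1 ⊗ₖ L z.2) ρ) := by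
  have hrow : ∀ (z : (ι → Y) × (ι → Z)) (p : (ι → C) × (ι → D)),
      star ((tensorKraus ι K z.1 ⊗ₖ tensorKraus ι L z.2) p) =
        prodVec fun i => star ((K (z.1 i) ⊗ₖ L (z.2 i)) (p.1 i, p.2 i)) := fun z p => by
    ext s
    simp [prodVec, tensorKraus, Matrix.kroneckerMap_apply, Finset.prod_mul_distrib]
  ext p q
  simp only [krausMap_apply, Matrix.sum_apply, mul_mul_conjTranspose_apply, hrow,
    sesqForm_tensorPow]
  rw [sum_prod_arrow fun i (z : Y × Z) => sesqForm ρ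
    (star ((K z.1 ⊗ₖ L z.2) (p.1 i, p.2 i))) (star ((K z.1 ⊗ₖ L z.2) (q.1 i, q.2 i)))]
  simp [tensorPow, Matrix.sum_apply, mul_mul_conjTranspose_apply]

end TensorPow

open scoped MatrixOrder in
theorem posSemidef_tensorPow {ι A B : Type*} [Fintype ι] [Finite A] [Finite B]
    {ρ : Matrix (A × B) (A × B) ℂ} (hρ : ρ.PosSemidef) : (tensorPow ι ρ).PosSemidef := by
  classical
  cases nonempty_fintype A
  cases nonempty_fintype B
  obtain ⟨R, rfl⟩ := CStarAlgebra.nonneg_iff_eq_star_mul_self.mp hρ.nonneg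
  have h : tensorPow ι (star R * R) = (tensorPow ι R)ᴴ * tensorPow ι R := by
    ext p q
    simp only [tensorPow, Matrix.of_apply, Matrix.mul_apply, Matrix.star_apply,
      Matrix.conjTranspose_apply, star_prod, ← Finset.prod_mul_distrib]
    exact (sum_prod_arrow fun i r => star (R r (p.1 i, p.2 i)) * R r (q.1 i, q.2 i)).symm
  rw [h]
  exact Matrix.posSemidef_conjTranspose_mul_self _

theorem isState_tensorPow {ι A B : Type*} [Fintype ι] [DecidableEq ι] [Fintype A] [Fintype B]
    {ρ : Matrix (A × B) (A × B) ℂ} (hρ : IsState ρ) : IsState (tensorPow ι ρ) :=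
  ⟨posSemidef_tensorPow hρ.1, by rw [trace_tensorPow, hρ.2, one_pow]⟩

section Regroup

variable {ι κ μ ν : Type*}

/-- Groups the copies indexed by `ι` into blocks `μ` indexed by `κ`, and a remainder `ν`. -/
def regroupEquiv (e : ι ≃ (κ × μ) ⊕ ν) (A : Type*) : (ι → A) ≃ (κ → μ → A) × (ν → A) where
  toFun s := (fun k m => s (e.symm (.inl (k, m))), fun v => s (e.symm (.inr v)))
  invFun q i := Sum.elim (fun p => q.1 p.1 p.2) q.2 (e i)
  left_inv s := by
    ext i
    obtain ⟨x | x, rfl⟩ := e.symm.surjective i <;> simp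
  right_inv q := by simp

variable [Fintype ι] [Fintype κ] [Fintype μ] [Fintype ν] {A B : Type*} [Fintype A] [Fintype B]
  [DecidableEq ι] [DecidableEq ν] [DecidableEq A] [DecidableEq B]

theorem krausMap_regroupEquiv_tensorPow (e : ι ≃ (κ × μ) ⊕ ν)
    (ρ : Matrix (A × B) (A × B) ℂ) :
    krausMap (relabelKraus (relabelRight (regroupEquiv e A) fun _ => regroupEquiv e B))
        (tensorPow ι ρ) =
      ρ.trace ^ Fintype.card ν • tensorPow κ (tensorPow μ ρ) := by
  let G : (ι → A) × (ι → B) ≃ ((κ → μ → A) × (κ → μ → B)) × ((ν → A) × (ν → B)) :=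
    ((regroupEquiv e A).prodCongr (regroupEquiv e B)).trans (Equiv.prodProdProdComm _ _ _ _)
  have hprod : ∀ f : ι → ℂ, ∏ i, f i =
      (∏ k, ∏ m, f (e.symm (.inl (k, m)))) * ∏ v, f (e.symm (.inr v)) := fun f => by
    rw [← e.symm.prod_comp, Fintype.prod_sum_type, Fintype.prod_prod_type]
  ext c d
  refine (krausMap_relabelKraus_equiv G (tensorPow ι ρ) c d).trans ?_
  have hG : ∀ c r, G.symm (c, r) =
    ((regroupEquiv e A).symm (c.1, r.1), (regroupEquiv e B).symm (c.2, r.2)) := fun _ _ => rfl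
  simp only [tensorPow, Matrix.of_apply, hG, hprod, regroupEquiv, Equiv.coe_fn_symm_mk,
    Equiv.apply_symm_apply, Sum.elim_inl, Sum.elim_inr, Matrix.smul_apply, smul_eq_mul]
  rw [← Finset.mul_sum, sum_prod_arrow fun _ p => ρ p p, mul_comm, Finset.prod_const,
    Finset.card_univ]
  rfl

end Regroup

theorem exists_isLOCC_regroup {ι κ μ ν : Type} [Fintype ι] [Fintype κ] [Fintype μ] [Finite ν]
    [DecidableEq ι] [DecidableEq κ] [DecidableEq μ] {A B : Type} [Fintype A] [Fintype B]
    (e : ι ≃ (κ × μ) ⊕ ν) {ρ : Matrix (A × B) (A × B) ℂ} (hρ : ρ.trace = 1) :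
    ∃ Λ, IsLOCC Λ ∧ Λ (tensorPow ι ρ) = tensorPow κ (tensorPow μ ρ) := by
  classical
  cases nonempty_fintype ν
  refine ⟨_, isLOCC_relabelRight (regroupEquiv e A).injective fun _ => (regroupEquiv e B).injective,
    ?_⟩
  rw [krausMap_regroupEquiv_tensorPow, hρ, one_pow, one_smul]

/-! ### Selecting the first successful pair -/

section Selection

variable {M : ℕ} {C D : Type*}

/-- Extension by zero of a vector of `C : D` to the flagged spaces `Option C : Option D`, in which
`none` stands for a failure. -/
def flagExtend (w : C × D → ℂ) : Option C × Option D → ℂ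
  | (some c, some d) => w (c, d)
  | _ => 0

/-- The block of an operator on which both flags indicate success. -/
def successBlock (σ : Matrix (Option C × Option D) (Option C × Option D) ℂ) :
    Matrix (C × D) (C × D) ℂ :=
  σ.submatrix (Prod.map some some) (Prod.map some some)

theorem sesqForm_flagExtend [Fintype C] [Fintype D]
    (σ : Matrix (Option C × Option D) (Option C × Option D) ℂ) (u v : C × D → ℂ) :
    sesqForm σ (flagExtend u) (flagExtend v) = sesqForm (successBlock σ) u v := by
  simp [sesqForm_eq_sum, Fintype.sum_prod_type, Fintype.sum_option, flagExtend, successBlock]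

/-- The announcement of the flags of `M` flagged systems. -/
def flags (s : Fin M → Option C) : Fin M → Bool := fun j => (s j).isSome

/-- Erases the value, but not the flag, of the `i`-th flagged system. -/
def blank [Inhabited C] (i : Fin M) (s : Fin M → Option C) : Fin M → Option C :=
  Function.update s i ((s i).map fun _ => default)

/-- Splits the `i`-th flagged system off, with the value `default` in case of failure. -/
def extract [Inhabited C] (i : Fin M) (s : Fin M → Option C) : C × (Fin M → Option C) :=
  ((s i).getD default, blank i s)

/-- The first position at which both flags are raised (arbitrary if there is none). -/
def firstCommon [NeZero M] (c d : Fin M → Bool) : Fin M :=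
  Classical.epsilon fun i => IsLeast {j | c j = true ∧ d j = true} i

theorem firstCommon_eq [NeZero M] {c d : Fin M → Bool} {i : Fin M}
    (h : IsLeast {j | c j = true ∧ d j = true} i) : firstCommon c d = i :=
  IsLeast.unique (Classical.epsilon_spec ⟨i, h⟩) h

variable [Inhabited C] [Inhabited D]

theorem flags_blank (i : Fin M) (s : Fin M → Option C) : flags (blank i s) = flags s := by
  ext1 j
  rcases eq_or_ne j i with rfl | hj
  · simp [flags, blank]
  · simp [flags, blank, hj]

theorem extract_injective (i : Fin M) : Function.Injective (extract (C := C) i) := by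
  intro s t h
  simp only [extract, Prod.mk.injEq] at h
  ext1 j
  have hj := congrFun h.2 j
  rcases eq_or_ne j i with rfl | hne
  · simp only [blank, Function.update_self] at hj
    cases hs : s j <;> cases ht : t j <;> simp_all
  · simpa [blank, hne] using hj

theorem blank_eq_iff {i : Fin M} {s u : Fin M → Option C} (hu : u i = some default) :
    blank i s = u ↔ (s i).isSome = true ∧ ∀ j ≠ i, s j = u j := by
  rw [blank, Function.update_eq_iff, hu, Option.map_eq_some_iff]
  simp [Option.isSome_iff_exists]

/-- The effect on basis vectors of the following protocol: the first party announces its flags,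
the second party announces the first common success `i` and keeps the value of its `i`-th system,
and the first party does the same. -/
def selectRelabel [NeZero M] (p : (Fin M → Option C) × (Fin M → Option D)) :
    (C × D) × ((Fin M × (Fin M → Option C)) × ((Fin M → Bool) × (Fin M → Option D))) :=
  let i := firstCommon (flags p.1) (flags p.2)
  (((extract i p.1).1, (extract i p.2).1), ((i, blank i p.1), (flags p.1, blank i p.2)))

theorem selectRelabel_injective [NeZero M] :
    Function.Injective (selectRelabel (M := M) (C := C) (D := D)) := by
  rintro ⟨s, t⟩ ⟨s', t'⟩ h
  simp only [selectRelabel, Prod.mk.injEq] at h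
  obtain ⟨⟨hs, ht⟩, ⟨hi, hbs⟩, -, hbt⟩ := h
  rw [← hi] at hs ht hbs hbt
  exact Prod.ext (extract_injective _ (Prod.ext hs hbs)) (extract_injective _ (Prod.ext ht hbt))

theorem prodVec_flagExtend_apply {i : Fin M} {s₀ : Fin M → Option C} {t₀ : Fin M → Option D}
    (hs₀ : s₀ i = some default) (ht₀ : t₀ i = some default) [DecidableEq C] [DecidableEq D]
    (w : C × D → ℂ) (s : Fin M → Option C) (t : Fin M → Option D) :
    prodVec (fun j => if j = i then flagExtend w else Pi.single (s₀ j, t₀ j) 1) (s, t) =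
      if blank i s = s₀ ∧ blank i t = t₀ then w ((extract i s).1, (extract i t).1) else 0 := by
  rw [prodVec, ← Finset.mul_prod_erase _ _ (Finset.mem_univ i), if_pos rfl,
    Finset.prod_congr (g := fun j => if s j = s₀ j ∧ t j = t₀ j then 1 else 0) rfl
      fun j hj => by simp [Finset.ne_of_mem_erase hj, Pi.single_apply],
    Finset.prod_ite_zero, Finset.prod_const_one]
  rcases hs : s i with _ | c <;> rcases ht : t i with _ | d <;>
    simp [flagExtend, extract, blank_eq_iff hs₀, blank_eq_iff ht₀, hs, ht, forall_and]

theorem conjTranspose_selectRelabel_mulVec [NeZero M] [Fintype C] [Fintype D] [DecidableEq C]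
    [DecidableEq D] {i : Fin M} {s : Fin M → Option C} {t : Fin M → Option D}
    (hs : s i = some default) (ht : t i = some default)
    (hi : IsLeast {j | flags s j = true ∧ flags t j = true} i) (w : C × D → ℂ) :
    (relabelKraus selectRelabel ((i, s), (flags s, t)))ᴴ *ᵥ w =
      prodVec fun j => if j = i then flagExtend w else Pi.single (s j, t j) 1 := by
  ext ⟨s', t'⟩
  rw [conjTranspose_relabelKraus_mulVec, prodVec_flagExtend_apply hs ht]
  have hannounced : blank i s' = s ∧ blank i t' = t → firstCommon (flags s') (flags t') = i :=
    fun h => firstCommon_eq <| by rwa [← flags_blank i s', ← flags_blank i t', h.1, h.2]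
  have hlabel : (selectRelabel (s', t')).2 = ((i, s), (flags s, t)) ↔
      blank i s' = s ∧ blank i t' = t := by
    simp only [selectRelabel, Prod.mk.injEq]
    refine ⟨fun ⟨⟨hi', hs'⟩, _, ht'⟩ => by rw [hi'] at hs' ht'; exact ⟨hs', ht'⟩, fun h => ?_⟩
    rw [hannounced h, ← flags_blank i s', h.1]
    exact ⟨⟨rfl, rfl⟩, rfl, h.2⟩
  by_cases h : blank i s' = s ∧ blank i t' = t
  · rw [if_pos (hlabel.mpr h), if_pos h, selectRelabel, hannounced h]
  · rw [if_neg (mt hlabel.mp h), if_neg h]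

open scoped Classical in
/-- The contribution of the `j`-th pair, in the basis state `q`, to the fidelity obtained from
the first success at `i`: pair `i` contributes the fidelity `g`, and earlier pairs have failed. -/
def firstSuccessWeight (σ : Matrix (Option C × Option D) (Option C × Option D) ℂ) (g : ℂ)
    (i j : Fin M) (q : Option C × Option D) : ℂ :=
  if j = i then (if q = (some default, some default) then g else 0)
  else if j < i ∧ q.1.isSome ∧ q.2.isSome then 0 else σ q q

theorem sum_firstSuccessWeight [Fintype C] [Fintype D]
    (σ : Matrix (Option C × Option D) (Option C × Option D) ℂ) (g : ℂ) (i j : Fin M) :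
    ∑ q, firstSuccessWeight σ g i j q =
      if j = i then g else if j < i then σ.trace - (successBlock σ).trace else σ.trace := by
  rcases lt_trichotomy j i with hlt | rfl | hgt
  · simp only [firstSuccessWeight, hlt.ne, hlt, if_false, if_true, true_and]
    rw [eq_sub_iff_add_eq]
    simp only [Fintype.sum_prod_type, Fintype.sum_option, Option.isSome_none, Bool.false_eq_true,
      and_false, ↓reduceIte, Option.isSome_some, and_true, Finset.sum_ite_irrel,
      Finset.sum_const_zero, Finset.sum_add_distrib, add_zero, Matrix.trace, successBlock,
      Matrix.diag_apply, Matrix.submatrix_apply, Prod.map_apply]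
    ring
  · simp [firstSuccessWeight]
  · simp [firstSuccessWeight, hgt.ne', hgt.not_gt, Matrix.trace]

theorem sum_prod_firstSuccessWeight [Fintype C] [Fintype D]
    {σ : Matrix (Option C × Option D) (Option C × Option D) ℂ} (hσ : σ.trace = 1) (g : ℂ)
    (i : Fin M) :
    ∑ u : (Fin M → Option C) × (Fin M → Option D), ∏ j, firstSuccessWeight σ g i j (u.1 j, u.2 j) =
      (1 - (successBlock σ).trace) ^ (i : ℕ) * g := by
  rw [sum_prod_arrow (firstSuccessWeight σ g i)]
  have hfactor : ∀ j, ∑ q, firstSuccessWeight σ g i j q =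
      (if j < i then 1 - (successBlock σ).trace else 1) * if j = i then g else 1 := fun j => by
    rw [sum_firstSuccessWeight, hσ]
    rcases lt_trichotomy j i with hlt | rfl | hgt
    · simp [hlt, hlt.ne]
    · simp
    · simp [hgt.not_gt, hgt.ne']
  simp only [hfactor, Finset.prod_mul_distrib, Finset.prod_ite_eq', Finset.mem_univ, if_true]
  rw [Finset.prod_ite, Finset.prod_const, Finset.prod_const_one, mul_one,
    show Finset.univ.filter (· < i) = Finset.Iio i by ext; simp, Fin.card_Iio]

theorem prod_firstSuccessWeight_le [NeZero M] [Fintype C] [Fintype D] [DecidableEq C]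
    [DecidableEq D] {σ : Matrix (Option C × Option D) (Option C × Option D) ℂ}
    (hσ : σ.PosSemidef) (w : C × D → ℂ) (i : Fin M) (s : Fin M → Option C)
    (t : Fin M → Option D) :
    ∏ j, firstSuccessWeight σ (sesqForm (successBlock σ) w w) i j (s j, t j) ≤
      sesqForm (tensorPow (Fin M) σ) ((relabelKraus selectRelabel ((i, s), (flags s, t)))ᴴ *ᵥ w)
        ((relabelKraus selectRelabel ((i, s), (flags s, t)))ᴴ *ᵥ w) := by
  by_cases hst : s i = some default ∧ t i = some default
  swap
  · rw [Finset.prod_eq_zero (Finset.mem_univ i) (by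
      rw [firstSuccessWeight, if_pos rfl, if_neg (by simpa [Prod.ext_iff] using hst)])]
    exact sesqForm_self_nonneg (posSemidef_tensorPow hσ) _
  by_cases hfirst : ∀ j < i, ¬((s j).isSome ∧ (t j).isSome)
  swap
  · push Not at hfirst
    obtain ⟨j, hj, hsucc⟩ := hfirst
    rw [Finset.prod_eq_zero (Finset.mem_univ j) (by simp [firstSuccessWeight, hj.ne, hj, hsucc])]
    exact sesqForm_self_nonneg (posSemidef_tensorPow hσ) _
  have hi : IsLeast {j | flags s j = true ∧ flags t j = true} i :=
    ⟨by simp [flags, hst], fun j hj => not_lt.mp fun hlt => hfirst j hlt hj⟩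
  rw [conjTranspose_selectRelabel_mulVec hst.1 hst.2 hi, sesqForm_tensorPow]
  refine (Finset.prod_congr rfl fun j _ => ?_).le
  rcases eq_or_ne j i with rfl | hj
  · simp [firstSuccessWeight, hst, sesqForm_flagExtend]
  · simp only [firstSuccessWeight, if_neg hj, sesqForm_single]
    exact if_neg fun h => hfirst j h.1 h.2

theorem sum_le_sesqForm_selectRelabel [NeZero M] [Fintype C] [Fintype D] [DecidableEq C]
    [DecidableEq D] {σ : Matrix (Option C × Option D) (Option C × Option D) ℂ}
    (hσ : IsState σ) (w : C × D → ℂ) :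
    ∑ i : Fin M, (1 - (successBlock σ).trace) ^ (i : ℕ) * sesqForm (successBlock σ) w w ≤
      sesqForm (krausMap (relabelKraus selectRelabel) (tensorPow (Fin M) σ)) w w := by
  let label (k : Fin M × ((Fin M → Option C) × (Fin M → Option D))) :
      (Fin M × (Fin M → Option C)) × ((Fin M → Bool) × (Fin M → Option D)) :=
    ((k.1, k.2.1), (flags k.2.1, k.2.2))
  have hlabel : Function.Injective label := by
    rintro ⟨i, s, t⟩ ⟨i', s', t'⟩ h
    simp_all [label]
  refine le_trans ?_ (sum_sesqForm_le_sesqForm_krausMap _ (posSemidef_tensorPow hσ.1) w hlabel)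
  rw [Fintype.sum_prod_type]
  refine Finset.sum_le_sum fun i _ => ?_
  rw [← sum_prod_firstSuccessWeight hσ.2]
  exact Finset.sum_le_sum fun u _ => prod_firstSuccessWeight_le hσ.1 w i u.1 u.2

end Selection

theorem isLOCC_selectRelabel {M : ℕ} [NeZero M] {C D : Type} [Inhabited C] [Inhabited D]
    [Fintype C] [Fintype D] [DecidableEq C] [DecidableEq D] :
    IsLOCC (krausMap (relabelKraus (selectRelabel (M := M) (C := C) (D := D)))) := by
  let announce (s : Fin M → Option C) : (Fin M → Option C) × (Fin M → Bool) := (s, flags s)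
  let keep (c : Fin M → Bool) (t : Fin M → Option D) : (Fin M × D) × (Fin M → Option D) :=
    let i := firstCommon c (flags t)
    ((i, (extract i t).1), blank i t)
  have hannounce : Function.Injective announce := fun s t h => congrArg Prod.fst h
  have hkeep : ∀ c, Function.Injective (keep c) := fun c s t h => by
    simp only [keep, Prod.mk.injEq] at h
    obtain ⟨⟨hi, hval⟩, hblank⟩ := h
    rw [← hi] at hval hblank
    exact extract_injective _ (Prod.ext hval hblank)
  have hcomp := krausMap_relabelKraus_comp (relabelLeft (extract (C := C)) (Prod.swap (α := Fin M)))
    (relabelRight announce keep)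
  exact hcomp ▸ .comp (isLOCC_relabelRight hannounce hkeep)
    (isLOCC_relabelLeft extract_injective Prod.swap_injective)

/-! ### Filtering -/

section Filter

variable {A B C D : Type*}

/-- The Kraus operators of the measurement that tests whether the state lies in the span of the
rows of `S`: on success (outcome `none`) it applies the filter `S` and raises the flag, otherwise
it measures and discards the system, leaving the flag `none`. -/
def filterKraus [Fintype C] [DecidableEq A] (S : Matrix C A ℂ) :
    Option A → Matrix (Option C) A ℂ
  | none => Matrix.of fun q a => q.elim 0 fun c => S c a
  | some z => Matrix.of fun q a => q.elim ((1 - Sᴴ * S : Matrix A A ℂ) z a) fun _ => 0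

theorem isKrausFamily_filterKraus [Fintype A] [Fintype C] [DecidableEq A] [DecidableEq C]
    {S : Matrix C A ℂ} (hS : S * Sᴴ = 1) : IsKrausFamily (filterKraus S) := by
  have hsucc : (filterKraus S none)ᴴ * filterKraus S none = Sᴴ * S := by
    ext
    simp [Matrix.mul_apply, filterKraus, Fintype.sum_option]
  have hfail : ∑ z, (filterKraus S (some z))ᴴ * filterKraus S (some z) =
      (1 - Sᴴ * S)ᴴ * (1 - Sᴴ * S) := by
    ext a b
    rw [Matrix.sum_apply, Matrix.mul_apply]
    refine Finset.sum_congr rfl fun z _ => ?_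
    rw [Matrix.mul_apply, Fintype.sum_option]
    simp [filterKraus]
  have hproj : Sᴴ * S * (Sᴴ * S) = Sᴴ * S := by
    rw [Matrix.mul_assoc, ← Matrix.mul_assoc S, hS, Matrix.one_mul]
  rw [IsKrausFamily, Fintype.sum_option, hsucc, hfail, Matrix.conjTranspose_sub,
    Matrix.conjTranspose_mul, Matrix.conjTranspose_conjTranspose, Matrix.conjTranspose_one,
    Matrix.sub_mul, Matrix.mul_sub, Matrix.mul_sub, hproj]
  simp

theorem successBlock_krausMap_filterKraus [Fintype A] [Fintype B] [Fintype C] [Fintype D]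
    [DecidableEq A] [DecidableEq B] (S : Matrix C A ℂ) (T : Matrix D B ℂ)
    (ρ : Matrix (A × B) (A × B) ℂ) :
    successBlock (krausMap (fun z : Option A × Option B =>
        filterKraus S z.1 ⊗ₖ filterKraus T z.2) ρ) = (S ⊗ₖ T) * ρ * (S ⊗ₖ T)ᴴ := by
  have hrow : ∀ u v x, star ((filterKraus S u ⊗ₖ filterKraus T v) (Prod.map some some x)) =
      if u = none ∧ v = none then star ((S ⊗ₖ T) x) else 0 := by
    rintro (_ | _) (_ | _) ⟨c, d⟩ <;> ext ⟨a, b⟩ <;> simp [filterKraus]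
  ext x y
  rw [successBlock, Matrix.submatrix_apply, krausMap_apply, Matrix.sum_apply,
    Finset.sum_eq_single (none, none)]
  · simp only [mul_mul_conjTranspose_apply, hrow, and_self, if_true]
  · intro z _ hz
    simp [mul_mul_conjTranspose_apply, hrow, mt Prod.ext_iff.mpr hz, sesqForm]
  · simp

theorem trace_successBlock_le [Fintype C] [Fintype D]
    {σ : Matrix (Option C × Option D) (Option C × Option D) ℂ} (hσ : σ.PosSemidef) :
    (successBlock σ).trace ≤ σ.trace := by
  have hinj : Function.Injective (Prod.map (some (α := C)) (some (α := D))) :=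
    (Option.some_injective C).prodMap (Option.some_injective D)
  refine (Finset.sum_map Finset.univ ⟨_, hinj⟩ fun q => σ q q).symm.trans_le ?_
  exact Finset.sum_le_sum_of_subset_of_nonneg (Finset.subset_univ _) fun _ _ _ => hσ.diag_nonneg

theorem trace_filter_le_one [Fintype A] [Fintype B] [Fintype C] [Fintype D]
    [DecidableEq C] [DecidableEq D] {S : Matrix C A ℂ} {T : Matrix D B ℂ}
    (hS : S * Sᴴ = 1) (hT : T * Tᴴ = 1) {ρ : Matrix (A × B) (A × B) ℂ} (hρ : IsState ρ) :
    ((S ⊗ₖ T) * ρ * (S ⊗ₖ T)ᴴ).trace ≤ 1 := by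
  classical
  have hσ := ((isKrausFamily_filterKraus hS).kronecker (isKrausFamily_filterKraus hT)).isState hρ
  rw [← successBlock_krausMap_filterKraus, ← hσ.2]
  exact trace_successBlock_le hσ.1

end Filter

theorem exists_isLOCC_filter {A B C D : Type} [Fintype A] [Fintype B] [Fintype C] [Fintype D]
    [DecidableEq C] [DecidableEq D] [Inhabited C] [Inhabited D]
    {S : Matrix C A ℂ} {T : Matrix D B ℂ} (hS : S * Sᴴ = 1) (hT : T * Tᴴ = 1)
    {ρ : Matrix (A × B) (A × B) ℂ} (hρ : IsState ρ) (M : ℕ) [NeZero M] (w : C × D → ℂ) :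
    ∃ Λ, IsLOCC Λ ∧ IsState (Λ (tensorPow (Fin M) ρ)) ∧
      ∑ i : Fin M, (1 - ((S ⊗ₖ T) * ρ * (S ⊗ₖ T)ᴴ).trace) ^ (i : ℕ) *
          sesqForm ((S ⊗ₖ T) * ρ * (S ⊗ₖ T)ᴴ) w w ≤
        sesqForm (Λ (tensorPow (Fin M) ρ)) w w := by
  classical
  have hK := isKrausFamily_filterKraus hS
  have hL := isKrausFamily_filterKraus hT
  have hlocal := isLOCC_krausMap_right (isKrausFamily_tensorKraus (ι := Fin M) hK)
    fun _ => isKrausFamily_tensorKraus (ι := Fin M) hL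
  have hσ := (hK.kronecker hL).isState hρ
  refine ⟨_, .comp hlocal isLOCC_selectRelabel, ?_⟩
  rw [LinearMap.comp_apply, krausMap_tensorPow, ← successBlock_krausMap_filterKraus]
  exact ⟨(isKrausFamily_relabelKraus selectRelabel_injective).isState (isState_tensorPow hσ),
    sum_le_sesqForm_selectRelabel hσ w⟩

/-! ### Repetition codes -/

/-- The filter whose rows are the `m`-fold tensor powers of the rows of `S`: it projects onto the
repetition code in the basis given by the rows of `S`. -/
def rowPow {C A : Type*} (m : ℕ) (S : Matrix C A ℂ) : Matrix C (Fin m → A) ℂ :=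
  Matrix.of fun c a => ∏ j, S c (a j)

section RowPow

variable {A B C D : Type*} [Fintype A] [Fintype B] {m : ℕ}

theorem rowPow_mul_conjTranspose_apply (S : Matrix C A ℂ) (c d : C) :
    (rowPow m S * (rowPow m S)ᴴ) c d = (S * Sᴴ) c d ^ m := by
  simp only [Matrix.mul_apply, rowPow, Matrix.of_apply, Matrix.conjTranspose_apply, star_prod,
    ← Finset.prod_mul_distrib]
  rw [← Fintype.piFinset_univ, Finset.sum_prod_piFinset Finset.univ
    fun (_ : Fin m) a => S c a * star (S d a), Finset.prod_const, Finset.card_univ,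
    Fintype.card_fin]

theorem rowPow_mul_conjTranspose_eq_one [DecidableEq C] (hm : m ≠ 0) {S : Matrix C A ℂ}
    (hS : S * Sᴴ = 1) : rowPow m S * (rowPow m S)ᴴ = 1 := by
  ext c d
  rw [rowPow_mul_conjTranspose_apply, hS, Matrix.one_apply]
  split_ifs <;> simp [hm]

theorem rowPow_conj_tensorPow_apply (S : Matrix C A ℂ) (T : Matrix D B ℂ)
    (ρ : Matrix (A × B) (A × B) ℂ) (p q : C × D) :
    ((rowPow m S ⊗ₖ rowPow m T) * tensorPow (Fin m) ρ * (rowPow m S ⊗ₖ rowPow m T)ᴴ) p q =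
      ((S ⊗ₖ T) * ρ * (S ⊗ₖ T)ᴴ) p q ^ m := by
  have hrow : ∀ p, star ((rowPow m S ⊗ₖ rowPow m T) p) =
      prodVec fun _ : Fin m => star ((S ⊗ₖ T) p) := fun p => by
    ext u
    simp [prodVec, rowPow, Matrix.kroneckerMap_apply, Finset.prod_mul_distrib]
  simp [mul_mul_conjTranspose_apply, hrow, sesqForm_tensorPow]

end RowPow

/-- The two-qubit Bell-diagonal operator with diagonal entries `a, b, b, a` and antidiagonal
entries `c` (between `|00⟩` and `|11⟩`) and `d` (between `|01⟩` and `|10⟩`). -/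
def bellMatrix (a b c d : ℝ) : Matrix (Fin 2 × Fin 2) (Fin 2 × Fin 2) ℂ :=
  Matrix.of fun p q =>
    if p.1 = p.2 then (if q = p then (a : ℂ) else if q.1 = q.2 then (c : ℂ) else 0)
    else (if q = p then (b : ℂ) else if q.1 = q.2 then 0 else (d : ℂ))

theorem trace_bellMatrix (a b c d : ℝ) : (bellMatrix a b c d).trace = (2 * (a + b) : ℝ) := by
  simp only [Matrix.trace, bellMatrix, Matrix.diag_apply, Matrix.of_apply, ↓reduceIte,
    Fintype.sum_prod_type, Fin.sum_univ_two, zero_ne_one, one_ne_zero, Complex.ofReal_mul,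
    Complex.ofReal_ofNat, Complex.ofReal_add]
  ring

theorem inv_sqrt_two_mul_self : ((√2 : ℝ) : ℂ)⁻¹ * ((√2 : ℝ) : ℂ)⁻¹ = 1 / 2 := by
  rw [← mul_inv, ← Complex.ofReal_mul, Real.mul_self_sqrt zero_le_two]
  norm_num

theorem sesqForm_bellMatrix_phiPlusVec (a b c d : ℝ) :
    sesqForm (bellMatrix a b c d) phiPlusVec phiPlusVec = (a + c : ℝ) := by
  have hhalf : ∀ z : ℂ, ((√2 : ℝ) : ℂ)⁻¹ * z * ((√2 : ℝ) : ℂ)⁻¹ = 1 / 2 * z := fun z => by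
    rw [mul_right_comm, inv_sqrt_two_mul_self]
  simp only [bellMatrix, sesqForm_eq_sum, phiPlusVec, RCLike.star_def, Matrix.of_apply, mul_ite,
    mul_zero, ite_mul, zero_mul, Fintype.sum_prod_type, Finset.sum_ite_eq, Finset.mem_univ,
    ↓reduceIte, Finset.sum_ite_irrel, Fin.sum_univ_two, Prod.mk.injEq, and_true, one_ne_zero,
    and_false, add_zero, zero_ne_one, zero_add, map_inv₀, Complex.conj_ofReal, hhalf, one_div,
    Complex.ofReal_add]
  ring

/-- The filter projecting `k` qubits onto the repetition code in the computational basis. -/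
def repetitionFilter (k : ℕ) : Matrix (Fin 2) (Fin k → Fin 2) ℂ := rowPow k 1

theorem repetitionFilter_mul_conjTranspose {k : ℕ} (hk : k ≠ 0) :
    repetitionFilter k * (repetitionFilter k)ᴴ = 1 :=
  rowPow_mul_conjTranspose_eq_one hk (by simp)

theorem repetitionFilter_conj_bellMatrix {k : ℕ} (hk : k ≠ 0) (a b c d : ℝ) :
    (repetitionFilter k ⊗ₖ repetitionFilter k) * tensorPow (Fin k) (bellMatrix a b c d) *
        (repetitionFilter k ⊗ₖ repetitionFilter k)ᴴ =
      bellMatrix (a ^ k) (b ^ k) (c ^ k) (d ^ k) := by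
  ext p q
  rw [repetitionFilter, rowPow_conj_tensorPow_apply, Matrix.one_kronecker_one, Matrix.one_mul,
    Matrix.conjTranspose_one, Matrix.mul_one]
  simp only [bellMatrix, Matrix.of_apply]
  split_ifs <;> simp [hk]

/-- The Hadamard gate. -/
def hadamardGate : Matrix (Fin 2) (Fin 2) ℂ := ((√2 : ℝ) : ℂ)⁻¹ • !![1, 1; 1, -1]

theorem hadamardGate_mul_conjTranspose : hadamardGate * hadamardGateᴴ = 1 := by
  ext i j
  fin_cases i <;> fin_cases j <;>
    norm_num [hadamardGate, Matrix.mul_apply, inv_sqrt_two_mul_self]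

theorem hadamardGate_conj_bellMatrix (a b c d : ℝ) :
    (hadamardGate ⊗ₖ hadamardGate) * bellMatrix a b c d * (hadamardGate ⊗ₖ hadamardGate)ᴴ =
      bellMatrix ((a + c + b + d) / 2) ((a - c + b - d) / 2) ((a + c - b - d) / 2)
        ((a - c - b + d) / 2) := by
  have h : hadamardGate ⊗ₖ hadamardGate = (1 / 2 : ℂ) •
      (!![1, 1; 1, -1] : Matrix (Fin 2) (Fin 2) ℂ) ⊗ₖ !![1, 1; 1, -1] := by
    rw [hadamardGate, Matrix.smul_kronecker, Matrix.kronecker_smul, smul_smul,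
      inv_sqrt_two_mul_self]
  rw [h]
  ext ⟨x, y⟩ ⟨x', y'⟩
  fin_cases x <;> fin_cases y <;> fin_cases x' <;> fin_cases y' <;>
    simp [Matrix.mul_apply, Fintype.sum_prod_type, bellMatrix] <;> ring

/-- The filter projecting onto the concatenation of two repetition codes in complementary bases:
the inner one, of length `k`, suppresses bit flips, the outer one, of length `m`, phase flips. -/
def codeFilter (m k : ℕ) : Matrix (Fin 2) (Fin m → Fin k → Fin 2) ℂ :=
  rowPow m (hadamardGate * repetitionFilter k)

theorem codeFilter_mul_conjTranspose {m k : ℕ} (hm : m ≠ 0) (hk : k ≠ 0) :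
    codeFilter m k * (codeFilter m k)ᴴ = 1 := by
  refine rowPow_mul_conjTranspose_eq_one hm ?_
  rw [Matrix.conjTranspose_mul, Matrix.mul_assoc, ← Matrix.mul_assoc (repetitionFilter k),
    repetitionFilter_mul_conjTranspose hk, Matrix.one_mul, hadamardGate_mul_conjTranspose]

theorem codeFilter_conj_bellMatrix {m k : ℕ} (hm : m ≠ 0) (hk : k ≠ 0) (a b c : ℝ) :
    (codeFilter m k ⊗ₖ codeFilter m k) *
        tensorPow (Fin m) (tensorPow (Fin k) (bellMatrix a b c 0)) *
        (codeFilter m k ⊗ₖ codeFilter m k)ᴴ =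
      bellMatrix (((a ^ k + c ^ k + b ^ k) / 2) ^ m) (((a ^ k - c ^ k + b ^ k) / 2) ^ m)
        (((a ^ k + c ^ k - b ^ k) / 2) ^ m) (((a ^ k - c ^ k - b ^ k) / 2) ^ m) := by
  have hinner := hadamardGate_conj_bellMatrix (a ^ k) (b ^ k) (c ^ k) (0 ^ k)
  rw [← repetitionFilter_conj_bellMatrix hk, zero_pow hk, add_zero, sub_zero, sub_zero,
    add_zero] at hinner
  ext p q
  rw [codeFilter, rowPow_conj_tensorPow_apply, Matrix.mul_kronecker_mul, Matrix.conjTranspose_mul]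
  simp only [Matrix.mul_assoc] at hinner ⊢
  rw [hinner]
  simp only [bellMatrix, Matrix.of_apply]
  split_ifs <;> simp [hm]

/-! ### Choosing the code lengths -/

theorem exists_one_sub_pow_bounds {β γ ε : ℝ} (hβ : 0 ≤ β) (hβ1 : β ≤ 1) (hγ : 0 < γ)
    (hγ1 : γ ≤ 1) (hε : 0 < ε) (hβγ : (2 / ε + 1) * β ≤ ε * γ) :
    ∃ m : ℕ, m ≠ 0 ∧ 1 - ε ≤ (1 - β) ^ m ∧ (1 - γ) ^ m ≤ ε / 2 := by
  have hlen : 0 < 2 / (ε * γ) := by positivity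
  refine ⟨⌈2 / (ε * γ)⌉₊, (Nat.ceil_pos.mpr hlen).ne', ?_, ?_⟩
  all_goals
    have hle := Nat.le_ceil (2 / (ε * γ))
    have hlt := (Nat.ceil_lt_add_one hlen.le).le
    generalize ⌈2 / (ε * γ)⌉₊ = m at *
  · have hmβ : m * β ≤ ε := calc
      m * β ≤ (2 / (ε * γ) + 1) * β := by gcongr
      _ ≤ (2 / (ε * γ) + 1 / γ) * β := by gcongr; exact (one_le_div hγ).mpr hγ1
      _ = (2 / ε + 1) * β / γ := by field_simp
      _ ≤ ε := (div_le_iff₀ hγ).mpr hβγ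
    calc 1 - ε ≤ 1 + m * (-β) := by linarith
      _ ≤ (1 + -β) ^ m := one_add_mul_le_pow (by linarith) m
      _ = (1 - β) ^ m := by rw [sub_eq_add_neg]
  · have hmγ : 2 / ε ≤ m * γ := calc
      2 / ε = 2 / (ε * γ) * γ := by field_simp
      _ ≤ m * γ := by gcongr
    have : 0 ≤ (1 - γ) ^ m := pow_nonneg (by linarith) m
    have hprod : (1 - γ) ^ m * (2 / ε) ≤ 1 := calc
      (1 - γ) ^ m * (2 / ε) ≤ (1 - γ) ^ m * (1 + m * γ) := by gcongr; linarith
      _ ≤ (1 - γ) ^ m * (1 + γ) ^ m := by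
        gcongr; exact one_add_mul_le_pow (by linarith) m
      _ = (1 - γ ^ 2) ^ m := by rw [← mul_pow]; ring
      _ ≤ 1 := pow_le_one₀ (by nlinarith) (by nlinarith)
    rw [← mul_div_assoc, div_le_one hε] at hprod
    linarith

theorem exists_code_length {A B C ε : ℝ} (hB : 0 ≤ B) (hC : 0 < C) (hBC : B ≤ C) (hCA : C ≤ A)
    (hε : 0 < ε) (hratio : (2 / ε + 1) * (B / C) ≤ ε) : ∃ m : ℕ, m ≠ 0 ∧
      0 < 2 * (((A + C + B) / 2) ^ m + ((A - C + B) / 2) ^ m) ∧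
      (1 - ε) * (2 * (((A + C + B) / 2) ^ m + ((A - C + B) / 2) ^ m)) ≤
        ((A + C + B) / 2) ^ m + ((A + C - B) / 2) ^ m := by
  have hsum : 0 < A + C + B := by linarith
  obtain ⟨m, hm, hx, hy⟩ := exists_one_sub_pow_bounds (β := 2 * B / (A + C + B))
    (γ := 2 * C / (A + C + B)) (by positivity) ((div_le_one hsum).mpr (by linarith))
    (by positivity) ((div_le_one hsum).mpr (by linarith)) hε (by
      rw [← mul_div_assoc, ← mul_div_assoc]
      gcongr ?_ / _
      rw [← mul_div_assoc, div_le_iff₀ hC] at hratio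
      linarith)
  have hyD : (A - C + B) / 2 = (A + C + B) / 2 * (1 - 2 * C / (A + C + B)) := by
    field_simp; ring
  have hxD : (A + C - B) / 2 = (A + C + B) / 2 * (1 - 2 * B / (A + C + B)) := by
    field_simp; ring
  have hy0 : 0 ≤ (1 - 2 * C / (A + C + B)) ^ m :=
    pow_nonneg (sub_nonneg.mpr ((div_le_one hsum).mpr (by linarith))) m
  refine ⟨m, hm, ?_⟩
  rw [hyD, hxD, mul_pow, mul_pow]
  generalize (1 - 2 * C / (A + C + B)) ^ m = y at *
  generalize (1 - 2 * B / (A + C + B)) ^ m = x at *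
  refine ⟨by positivity, ?_⟩
  calc (1 - ε) * (2 * (((A + C + B) / 2) ^ m + ((A + C + B) / 2) ^ m * y))
      = ((A + C + B) / 2) ^ m * ((1 - ε) * (2 * (1 + y))) := by ring
    _ ≤ ((A + C + B) / 2) ^ m * (1 + x) := by gcongr; nlinarith
    _ = ((A + C + B) / 2) ^ m + ((A + C + B) / 2) ^ m * x := by ring

theorem exists_code_parameters {a b c ε : ℝ} (hb : 0 ≤ b) (hbc : b < c) (hca : c ≤ a)
    (hε : 0 < ε) : ∃ m k : ℕ, m ≠ 0 ∧ k ≠ 0 ∧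
      0 < 2 * (((a ^ k + c ^ k + b ^ k) / 2) ^ m + ((a ^ k - c ^ k + b ^ k) / 2) ^ m) ∧
      (1 - ε) * (2 * (((a ^ k + c ^ k + b ^ k) / 2) ^ m + ((a ^ k - c ^ k + b ^ k) / 2) ^ m)) ≤
        ((a ^ k + c ^ k + b ^ k) / 2) ^ m + ((a ^ k + c ^ k - b ^ k) / 2) ^ m := by
  have hc : 0 < c := hb.trans_lt hbc
  have hratio : Filter.Tendsto (fun k : ℕ => (2 / ε + 1) * (b / c) ^ k) Filter.atTop (nhds 0) := by
    simpa using (tendsto_pow_atTop_nhds_zero_of_lt_one (div_nonneg hb hc.le)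
      ((div_lt_one hc).mpr hbc)).const_mul (2 / ε + 1)
  obtain ⟨k, hk, hk0⟩ := ((hratio.eventually_le_const hε).and
    (Filter.eventually_ne_atTop 0)).exists
  rw [div_pow] at hk
  obtain ⟨m, hm, hpos, hle⟩ := exists_code_length (pow_nonneg hb k) (pow_pos hc k)
    (pow_le_pow_left₀ hb hbc.le k) (pow_le_pow_left₀ hc.le hca k) hε hk
  exact ⟨m, k, hm, hk0, hpos, hle⟩

/-! ### The trace norm -/

theorem traceNorm_nonneg {A : Type*} [Fintype A] [DecidableEq A] (X : Matrix A A ℂ) :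
    0 ≤ traceNorm X :=
  Finset.sum_nonneg fun _ _ => Real.sqrt_nonneg _

theorem traceNorm_le_sqrt {A : Type*} [Fintype A] [DecidableEq A] (X : Matrix A A ℂ) :
    traceNorm X ≤ √(Fintype.card A) * √((Xᴴ * X).trace.re) := by
  have hpos := Matrix.posSemidef_conjTranspose_mul_self X
  have htrace : (Xᴴ * X).trace.re = ∑ i, hpos.1.eigenvalues i := by
    simp [hpos.1.trace_eq_sum_eigenvalues]
  rw [htrace, traceNorm]
  simpa using Real.sum_sqrt_mul_sqrt_le Finset.univ (f := fun _ => (1 : ℝ))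
    (fun _ => zero_le_one) hpos.eigenvalues_nonneg

section PosSemidef

variable {A : Type*} {X : Matrix A A ℂ}

theorem norm_apply_sq_le_of_posSemidef (hX : X.PosSemidef) (i j : A) :
    ‖X i j‖ ^ 2 ≤ (X i i).re * (X j j).re := by
  have hdet := (hX.submatrix ![i, j]).det_nonneg
  rw [Matrix.det_fin_two] at hdet
  have him : ∀ i, (X i i).im = 0 := fun i => Complex.conj_eq_iff_im.mp (hX.1.apply i i)
  have hdet_re := (Complex.le_def.mp hdet).1
  simp only [Matrix.submatrix_apply, Matrix.cons_val_zero, Matrix.cons_val_one,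
    ← hX.1.apply j i, Complex.star_def, Complex.mul_conj, Complex.sub_re, Complex.mul_re, him,
    Complex.zero_re, Complex.ofReal_re, mul_zero, sub_zero] at hdet_re
  rw [← Complex.normSq_eq_norm_sq]
  linarith

variable [Fintype A]

theorem trace_mul_self_le_of_posSemidef (hX : X.PosSemidef) :
    (X * X).trace.re ≤ X.trace.re ^ 2 := by
  have hentries : (X * X).trace.re = ∑ i, ∑ j, ‖X i j‖ ^ 2 := by
    simp only [Matrix.trace, Matrix.diag_apply, Matrix.mul_apply, Complex.re_sum]
    refine Finset.sum_congr rfl fun i _ => Finset.sum_congr rfl fun j _ => ?_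
    rw [← hX.1.apply j i, Complex.star_def, Complex.mul_conj, Complex.ofReal_re,
      Complex.normSq_eq_norm_sq]
  rw [hentries, sq, Matrix.trace, Complex.re_sum, Finset.sum_mul_sum]
  exact Finset.sum_le_sum fun i _ => Finset.sum_le_sum fun j _ =>
    norm_apply_sq_le_of_posSemidef hX i j

theorem sesqForm_self_eq_trace (X : Matrix A A ℂ) (v : A → ℂ) :
    sesqForm X v v = (X * Matrix.vecMulVec v (star v)).trace := by
  rw [Matrix.mul_vecMulVec, Matrix.trace_vecMulVec, sesqForm, dotProduct_comm]

theorem vecMulVec_star_mul_self {v : A → ℂ} (hv : star v ⬝ᵥ v = 1) :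
    Matrix.vecMulVec v (star v) * Matrix.vecMulVec v (star v) = Matrix.vecMulVec v (star v) := by
  rw [Matrix.vecMulVec_mul_vecMulVec, hv]
  simp

theorem traceNorm_sub_vecMulVec_le [DecidableEq A] (hX : IsState X) {v : A → ℂ}
    (hv : star v ⬝ᵥ v = 1) :
    traceNorm (X - Matrix.vecMulVec v (star v)) ≤
      √(Fintype.card A) * √(2 * (1 - (sesqForm X v v).re)) := by
  refine (traceNorm_le_sqrt _).trans ?_
  gcongr
  have hpurity := trace_mul_self_le_of_posSemidef hX.1
  rw [hX.2] at hpurity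
  rw [sesqForm_self_eq_trace, Matrix.conjTranspose_sub, hX.1.1.eq,
    (Matrix.posSemidef_vecMulVec_self_star v).1.eq, Matrix.sub_mul, Matrix.mul_sub, Matrix.mul_sub,
    vecMulVec_star_mul_self hv]
  simp only [Matrix.trace_sub, Matrix.trace_mul_comm _ X, Complex.sub_re]
  rw [Matrix.trace_vecMulVec, dotProduct_comm, hv]
  simp only [Complex.one_re] at hpurity ⊢
  linarith

end PosSemidef

theorem star_phiPlusVec_dotProduct : star phiPlusVec ⬝ᵥ phiPlusVec = 1 := by
  simp [dotProduct, phiPlusVec, Fintype.sum_prod_type, inv_sqrt_two_mul_self]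

/-! ### Distillation -/

theorem exists_tendsto_zero_of_forall_eventually_exists_le {X : ℕ → Type*} [∀ n, Nonempty (X n)]
    {f : ∀ n, X n → ℝ} (hf : ∀ n x, 0 ≤ f n x)
    (h : ∀ ε > 0, ∀ᶠ n in Filter.atTop, ∃ x, f n x ≤ ε) :
    ∃ x : ∀ n, X n, Filter.Tendsto (fun n => f n (x n)) Filter.atTop (nhds 0) := by
  have hbdd : ∀ n, BddBelow (Set.range (f n)) := fun n => ⟨0, by rintro _ ⟨x, rfl⟩; exact hf n x⟩
  choose x hx using fun n : ℕ => exists_lt_of_ciInf_lt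
    (lt_add_of_pos_right (⨅ x, f n x) (Nat.one_div_pos_of_nat (α := ℝ) (n := n)))
  have hinf : Filter.Tendsto (fun n => ⨅ x, f n x) Filter.atTop (nhds 0) := by
    refine tendsto_order.mpr ⟨fun a ha => .of_forall fun n => ha.trans_le (Real.iInf_nonneg (hf n)),
      fun ε hε => (h (ε / 2) (half_pos hε)).mono fun n => ?_⟩
    rintro ⟨y, hy⟩
    exact ((ciInf_le (hbdd n) y).trans hy).trans_lt (half_lt_self hε)
  refine ⟨x, squeeze_zero (fun n => hf n _) (fun n => (hx n).le) ?_⟩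
  simpa using hinf.add tendsto_one_div_add_atTop_nhds_zero_nat

theorem exists_isLOCC {A B C D : Type} [Fintype A] [Fintype B] [Fintype C] [Fintype D]
    [Nonempty C] [Nonempty D] :
    ∃ Λ : Matrix (A × B) (A × B) ℂ →ₗ[ℂ] Matrix (C × D) (C × D) ℂ, IsLOCC Λ := by
  classical
  exact ⟨_, isLOCC_relabelRight (Prod.mk_right_injective (Classical.arbitrary C))
    fun _ => Prod.mk_right_injective (Classical.arbitrary D)⟩

theorem isLOCCDistillable_of_forall_fidelity {A B : Type} [Fintype A] [Fintype B]
    {ρ : Matrix (A × B) (A × B) ℂ}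
    (h : ∀ ε > 0, ∀ᶠ n in Filter.atTop, ∃ Λ, IsLOCC Λ ∧ IsState (Λ (tensorPower ρ n)) ∧
      1 - ε ≤ (sesqForm (Λ (tensorPower ρ n)) phiPlusVec phiPlusVec).re) :
    IsLOCCDistillable ρ := by
  let LOCC (n : ℕ) : Type := {Λ : Matrix ((Fin n → A) × (Fin n → B)) ((Fin n → A) × (Fin n → B)) ℂ
    →ₗ[ℂ] Matrix (Fin 2 × Fin 2) (Fin 2 × Fin 2) ℂ // IsLOCC Λ}
  have : ∀ n, Nonempty (LOCC n) := fun n => by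
    obtain ⟨Λ, hΛ⟩ := exists_isLOCC (A := Fin n → A) (B := Fin n → B) (C := Fin 2) (D := Fin 2)
    exact ⟨⟨Λ, hΛ⟩⟩
  have hclose : ∀ ε > 0, ∀ᶠ n in Filter.atTop, ∃ Λ : LOCC n,
      traceNorm (Λ.1 (tensorPower ρ n) - phiPlus) ≤ ε := by
    refine fun ε hε => (h (ε ^ 2 / 8) (by positivity)).mono fun n => ?_
    rintro ⟨Λ, hΛ, hstate, hfid⟩
    refine ⟨⟨Λ, hΛ⟩, (traceNorm_sub_vecMulVec_le hstate star_phiPlusVec_dotProduct).trans ?_⟩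
    rw [← Real.sqrt_mul (Nat.cast_nonneg _)]
    refine Real.sqrt_le_iff.mpr ⟨hε.le, ?_⟩
    norm_num
    linarith
  obtain ⟨Λ, hΛ⟩ := exists_tendsto_zero_of_forall_eventually_exists_le
    (fun _ _ => traceNorm_nonneg _) hclose
  exact ⟨fun n => (Λ n).1, fun n => (Λ n).2, hΛ⟩

theorem exists_one_sub_le_sum_pow_mul {P F ε : ℝ} (hP : 0 < P) (hP1 : P ≤ 1) (hε : 0 < ε)
    (hF : (1 - ε / 2) * P ≤ F) :
    ∃ M : ℕ, M ≠ 0 ∧ 1 - ε ≤ ∑ i : Fin M, (1 - P) ^ (i : ℕ) * F := by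
  obtain ⟨M, hpow, hM⟩ := (((tendsto_pow_atTop_nhds_zero_of_lt_one (by linarith)
    (show 1 - P < 1 by linarith)).eventually_le_const (half_pos hε)).and
      (Filter.eventually_ne_atTop 0)).exists
  refine ⟨M, hM, ?_⟩
  rw [Fin.sum_univ_eq_sum_range fun i => (1 - P) ^ i * F, ← Finset.sum_mul]
  have hgeom := mul_neg_geom_sum (1 - P) M
  rw [sub_sub_cancel] at hgeom
  have hpow_nonneg : 0 ≤ (1 - P) ^ M := pow_nonneg (by linarith) M
  calc 1 - ε ≤ (1 - ε / 2) * (1 - (1 - P) ^ M) := by nlinarith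
    _ = (∑ i ∈ Finset.range M, (1 - P) ^ i) * ((1 - ε / 2) * P) := by rw [← hgeom]; ring
    _ ≤ (∑ i ∈ Finset.range M, (1 - P) ^ i) * F := by gcongr

theorem exists_isLOCC_nested_blocks {A B : Type} [Fintype A] [Fintype B]
    {ρ : Matrix (A × B) (A × B) ℂ} (hρ : IsState ρ) {M m k n : ℕ} (hn : M * m * k ≤ n) :
    ∃ Λ, IsLOCC Λ ∧ Λ (tensorPow (Fin n) ρ) =
      tensorPow (Fin M) (tensorPow (Fin m) (tensorPow (Fin k) ρ)) := by
  have split : Fin n ≃ ((Fin M × Fin m) × Fin k) ⊕ Fin (n - M * m * k) :=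
    Fintype.equivOfCardEq (by simp; omega)
  obtain ⟨Λ, hΛ, hΛρ⟩ := exists_isLOCC_regroup split hρ.2
  obtain ⟨Θ, hΘ, hΘρ⟩ := exists_isLOCC_regroup (Equiv.sumEmpty (Fin M × Fin m) (Fin 0)).symm
    (isState_tensorPow (ι := Fin k) hρ).2
  exact ⟨_, hΛ.comp hΘ, by rw [LinearMap.comp_apply, hΛρ, hΘρ]⟩

theorem eventually_exists_isLOCC_fidelity_bellMatrix {a b c : ℝ} (hb : 0 ≤ b) (hbc : b < c)
    (hca : c ≤ a) (hstate : IsState (bellMatrix a b c 0)) {ε : ℝ} (hε : 0 < ε) :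
    ∀ᶠ n in Filter.atTop, ∃ Λ, IsLOCC Λ ∧ IsState (Λ (tensorPower (bellMatrix a b c 0) n)) ∧
      1 - ε ≤ (sesqForm (Λ (tensorPower (bellMatrix a b c 0) n)) phiPlusVec phiPlusVec).re := by
  obtain ⟨m, k, hm, hk, hP, hF⟩ := exists_code_parameters hb hbc hca (half_pos hε)
  have hS := codeFilter_mul_conjTranspose hm hk
  have hblock := isState_tensorPow (ι := Fin m) (isState_tensorPow (ι := Fin k) hstate)
  have hP1 := trace_filter_le_one hS hS hblock
  have hfilter := fun M [NeZero M] => exists_isLOCC_filter hS hS hblock M phiPlusVec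
  simp only [codeFilter_conj_bellMatrix hm hk, trace_bellMatrix,
    sesqForm_bellMatrix_phiPlusVec] at hP1 hfilter
  obtain ⟨M, hM, hsum⟩ := exists_one_sub_le_sum_pow_mul hP (by exact_mod_cast hP1) hε hF
  have : NeZero M := ⟨hM⟩
  obtain ⟨Λ, hΛ, hΛstate, hfid⟩ := hfilter M
  filter_upwards [Filter.eventually_ge_atTop (M * m * k)] with n hn
  obtain ⟨Θ, hΘ, hΘρ⟩ := exists_isLOCC_nested_blocks hstate hn
  refine ⟨_, hΘ.comp hΛ, ?_⟩
  rw [show tensorPower (bellMatrix a b c 0) n = tensorPow (Fin n) (bellMatrix a b c 0) from rfl,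
    LinearMap.comp_apply, hΘρ]
  refine ⟨hΛstate, hsum.trans ?_⟩
  have hfid_re := (Complex.le_def.mp hfid).1
  exact_mod_cast hfid_re

theorem isLOCCDistillable_bellMatrix {a b c : ℝ} (hb : 0 ≤ b) (hbc : b < c) (hca : c ≤ a)
    (hstate : IsState (bellMatrix a b c 0)) : IsLOCCDistillable (bellMatrix a b c 0) :=
  isLOCCDistillable_of_forall_fidelity fun _ hε =>
    eventually_exists_isLOCC_fidelity_bellMatrix hb hbc hca hstate hε

/-! ### The cone of separable operators -/

theorem isCompact_convexHull_of_finiteDimensional {E : Type*} [AddCommGroup E] [Module ℝ E]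
    [TopologicalSpace E] [ContinuousAdd E] [ContinuousSMul ℝ E] [FiniteDimensional ℝ E]
    {s : Set E} (hs : IsCompact s) : IsCompact (convexHull ℝ s) := by
  let combination (n : ℕ) (p : (Fin n → ℝ) × (Fin n → E)) : E := ∑ i, p.1 i • p.2 i
  have hcont : ∀ n, Continuous (combination n) := fun n => by fun_prop
  have hull_eq : convexHull ℝ s = ⋃ n ∈ Finset.range (Module.finrank ℝ E + 2),
      combination n '' (stdSimplex ℝ (Fin n) ×ˢ Set.univ.pi fun _ => s) := by
    refine Set.Subset.antisymm (fun x hx => ?_) (Set.iUnion₂_subset fun n _ => ?_)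
    · obtain ⟨ι, _, z, w, hz, hind, hw, hw1, rfl⟩ := eq_pos_convex_span_of_mem_convexHull hx
      have hcard : Fintype.card ι ≤ Module.finrank ℝ E + 1 :=
        hind.card_le_finrank_succ.trans (Nat.add_le_add_right (Submodule.finrank_le _) 1)
      let e := Fintype.equivFin ι
      exact Set.mem_biUnion (Finset.mem_coe.mpr (Finset.mem_range.mpr (Nat.lt_succ_of_le hcard)))
        ⟨(w ∘ e.symm, z ∘ e.symm), ⟨⟨fun i => (hw _).le, (e.symm.sum_comp w).trans hw1⟩,
          fun i _ => hz ⟨_, rfl⟩⟩, e.symm.sum_comp fun i => w i • z i⟩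
    · rintro _ ⟨⟨w, z⟩, ⟨⟨hw, hw1⟩, hz⟩, rfl⟩
      exact (convex_convexHull ℝ s).sum_mem (fun i _ => hw i) hw1
        fun i _ => subset_convexHull ℝ s (hz i trivial)
  rw [hull_eq]
  exact (Finset.range _).isCompact_biUnion fun n _ =>
    ((isCompact_stdSimplex ℝ (Fin n)).prod (isCompact_univ_pi fun _ => hs)).image (hcont n)

theorem isClosed_setOf_posSemidef (A : Type*) [Finite A] :
    IsClosed {X : Matrix A A ℂ | X.PosSemidef} := by
  cases nonempty_fintype A
  simp only [Matrix.posSemidef_iff_dotProduct_mulVec, Matrix.IsHermitian, Set.ofPred_and,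
    Set.ofPred_forall]
  exact (isClosed_eq (by fun_prop) (by fun_prop)).inter
    (isClosed_iInter fun v => isClosed_le continuous_const (by fun_prop))

section State

variable {A : Type*} [Fintype A]

theorem IsState.norm_apply_le_one {ρ : Matrix A A ℂ} (hρ : IsState ρ) (i j : A) :
    ‖ρ i j‖ ≤ 1 := by
  have hdiag_nonneg : ∀ i, 0 ≤ (ρ i i).re := fun i => (Complex.le_def.mp hρ.1.diag_nonneg).1
  have hdiag_sum : ∑ i, (ρ i i).re = 1 := by
    simpa [Matrix.trace] using congrArg Complex.re hρ.2
  have hdiag_le : ∀ i, (ρ i i).re ≤ 1 := fun i => hdiag_sum ▸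
    Finset.single_le_sum (f := fun i => (ρ i i).re) (fun i _ => hdiag_nonneg i) (Finset.mem_univ i)
  refine (sq_le_one_iff₀ (norm_nonneg _)).mp ?_
  exact (norm_apply_sq_le_of_posSemidef hρ.1 i j).trans
    (mul_le_one₀ (hdiag_le i) (hdiag_nonneg j) (hdiag_le j))

variable (A) in
theorem isCompact_setOf_isState : IsCompact {ρ : Matrix A A ℂ | IsState ρ} := by
  have hclosed : IsClosed {ρ : Matrix A A ℂ | IsState ρ} :=
    (isClosed_setOf_posSemidef A).inter (isClosed_eq (by fun_prop) (by fun_prop))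
  have hbox : IsCompact (Set.univ.pi fun _ : A => Set.univ.pi fun _ : A =>
      Metric.closedBall (0 : ℂ) 1) :=
    isCompact_univ_pi fun _ => isCompact_univ_pi fun _ => isCompact_closedBall _ _
  exact hbox.of_isClosed_subset hclosed fun ρ hρ i _ j _ =>
    mem_closedBall_zero_iff.mpr (hρ.norm_apply_le_one i j)

theorem eq_zero_or_exists_isState_of_posSemidef {τ : Matrix A A ℂ} (hτ : τ.PosSemidef) :
    τ = 0 ∨ ∃ (t : ℝ) (τ' : Matrix A A ℂ), 0 < t ∧ IsState τ' ∧ τ = (t : ℂ) • τ' := by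
  refine or_iff_not_imp_left.mpr fun hne => ?_
  have htrace : τ.trace ≠ 0 := hτ.trace_eq_zero_iff.not.mpr hne
  obtain ⟨t, ht⟩ : ∃ t : ℝ, τ.trace = t :=
    ⟨_, Complex.eq_re_of_ofReal_le (r := 0) (by simpa using hτ.trace_nonneg)⟩
  rw [ht, Complex.ofReal_ne_zero] at htrace
  have htpos : 0 < t := lt_of_le_of_ne (by exact_mod_cast ht ▸ hτ.trace_nonneg) htrace.symm
  refine ⟨t, ((t⁻¹ : ℝ) : ℂ) • τ, htpos,
    ⟨hτ.smul (by exact_mod_cast (inv_pos.mpr htpos).le), ?_⟩, ?_⟩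
  · rw [Matrix.trace_smul, ht, smul_eq_mul, ← Complex.ofReal_mul, inv_mul_cancel₀ htrace,
      Complex.ofReal_one]
  · rw [smul_smul, ← Complex.ofReal_mul, mul_inv_cancel₀ htrace, Complex.ofReal_one, one_smul]

end State

namespace IsSeparableOperator

variable {A B : Type*} {σ σ' : Matrix (A × B) (A × B) ℂ}

theorem kronecker {τ : Matrix A A ℂ} {ω : Matrix B B ℂ} (hτ : τ.PosSemidef)
    (hω : ω.PosSemidef) : IsSeparableOperator (τ ⊗ₖ ω) :=
  ⟨1, fun _ => τ, fun _ => ω, fun _ => hτ, fun _ => hω, by simp⟩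

theorem zero : IsSeparableOperator (0 : Matrix (A × B) (A × B) ℂ) :=
  ⟨0, Fin.elim0, Fin.elim0, fun i => i.elim0, fun i => i.elim0, by simp⟩

theorem one [Finite A] [Finite B] [DecidableEq A] [DecidableEq B] :
    IsSeparableOperator (1 : Matrix (A × B) (A × B) ℂ) := by
  rw [← Matrix.one_kronecker_one]
  exact kronecker .one .one

theorem add (h : IsSeparableOperator σ) (h' : IsSeparableOperator σ') :
    IsSeparableOperator (σ + σ') := by
  obtain ⟨m, τ, ω, hτ, hω, rfl⟩ := h
  obtain ⟨m', τ', ω', hτ', hω', rfl⟩ := h'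
  refine ⟨m + m', Fin.append τ τ', Fin.append ω ω', fun i => ?_, fun i => ?_, ?_⟩
  · cases i using Fin.addCases <;> simp [hτ, hτ']
  · cases i using Fin.addCases <;> simp [hω, hω']
  · simp [Fin.sum_univ_add]

theorem smul (h : IsSeparableOperator σ) {c : ℂ} (hc : 0 ≤ c) :
    IsSeparableOperator (c • σ) := by
  obtain ⟨m, τ, ω, hτ, hω, rfl⟩ := h
  exact ⟨m, fun i => c • τ i, ω, fun i => (hτ i).smul hc, hω, by
    simp [Finset.smul_sum, Matrix.smul_kronecker]⟩

theorem posSemidef [Finite A] [Finite B] (h : IsSeparableOperator σ) : σ.PosSemidef := by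
  have := Fintype.ofFinite A
  have := Fintype.ofFinite B
  obtain ⟨m, τ, ω, hτ, hω, rfl⟩ := h
  exact Matrix.posSemidef_sum _ fun i _ => (hτ i).kronecker (hω i)

end IsSeparableOperator

theorem convex_setOf_isSeparableOperator (A B : Type*) :
    Convex ℝ {σ : Matrix (A × B) (A × B) ℂ | IsSeparableOperator σ} :=
  fun _ hσ _ hσ' _ _ ha hb _ =>
    (hσ.smul (Complex.zero_le_real.mpr ha)).add (hσ'.smul (Complex.zero_le_real.mpr hb))

/-! ### Entanglement witnesses -/

/-- The convex hull of the product states, i.e. the separable states. -/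
def productStateHull (A B : Type*) [Fintype A] [Fintype B] : Set (Matrix (A × B) (A × B) ℂ) :=
  convexHull ℝ ((fun p : Matrix A A ℂ × Matrix B B ℂ => p.1 ⊗ₖ p.2) ''
    ({τ | IsState τ} ×ˢ {ω | IsState ω}))

section Witness

variable {A B : Type*} [Fintype A] [Fintype B]

theorem isClosed_productStateHull : IsClosed (productStateHull A B) := by
  have hcont : Continuous fun p : Matrix A A ℂ × Matrix B B ℂ => p.1 ⊗ₖ p.2 := by
    refine continuous_matrix fun i j => ?_
    simp only [Matrix.kroneckerMap_apply]
    fun_prop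
  exact (isCompact_convexHull_of_finiteDimensional
    (((isCompact_setOf_isState A).prod (isCompact_setOf_isState B)).image hcont)).isClosed

theorem kronecker_mem_productStateHull {τ : Matrix A A ℂ} {ω : Matrix B B ℂ} (hτ : IsState τ)
    (hω : IsState ω) : τ ⊗ₖ ω ∈ productStateHull A B :=
  subset_convexHull ℝ _ ⟨(τ, ω), ⟨hτ, hω⟩, rfl⟩

theorem isSeparableOperator_of_mem_productStateHull {σ : Matrix (A × B) (A × B) ℂ}
    (hσ : σ ∈ productStateHull A B) : IsSeparableOperator σ := by
  refine convexHull_min ?_ (convex_setOf_isSeparableOperator A B) hσ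
  rintro _ ⟨⟨τ, ω⟩, ⟨hτ, hω⟩, rfl⟩
  exact .kronecker hτ.1 hω.1

theorem exists_forall_eq_trace_mul {C R : Type*} [Fintype C] [CommSemiring R]
    (f : Matrix C C R →ₗ[R] R) : ∃ M : Matrix C C R, ∀ X, f X = (M * X).trace := by
  classical
  refine ⟨Matrix.of fun i j => f (Matrix.single j i 1), fun X => ?_⟩
  conv_lhs => rw [Matrix.matrix_eq_sum_single X, Finset.sum_comm]
  simp only [map_sum, Matrix.trace, Matrix.diag_apply, Matrix.mul_apply, Matrix.of_apply]
  refine Finset.sum_congr rfl fun i _ => Finset.sum_congr rfl fun j _ => ?_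
  rw [mul_comm, ← smul_eq_mul (X j i), ← map_smul, Matrix.smul_single, smul_eq_mul, mul_one]

theorem exists_isHermitian_forall_trace_mul_re_eq {C : Type*} [Fintype C]
    (f : Matrix C C ℂ →ₗ[ℂ] ℂ) : ∃ M : Matrix C C ℂ, M.IsHermitian ∧
      ∀ X : Matrix C C ℂ, X.IsHermitian → (M * X).trace.re = (f X).re := by
  obtain ⟨M, hM⟩ := exists_forall_eq_trace_mul f
  refine ⟨(1 / 2 : ℂ) • (M + Mᴴ), by simp [Matrix.IsHermitian, add_comm], fun X hX => ?_⟩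
  have hadj : (Mᴴ * X).trace = star (M * X).trace := by
    rw [← Matrix.trace_conjTranspose, Matrix.conjTranspose_mul, hX.eq, Matrix.trace_mul_comm]
  simp only [hM, Matrix.smul_mul, Matrix.add_mul, Matrix.trace_smul, Matrix.trace_add, hadj]
  simp only [smul_eq_mul, one_div, Complex.mul_re, Complex.inv_re, Complex.re_ofNat,
    Complex.normSq_ofNat, div_self_mul_self', Complex.add_re, RCLike.star_def, Complex.conj_re,
    Complex.inv_im, Complex.im_ofNat, neg_zero, zero_div, zero_mul, sub_zero]
  ring

theorem trace_mul_kronecker_nonneg_of_isState {W : Matrix (A × B) (A × B) ℂ}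
    (hW : ∀ τ ω, IsState τ → IsState ω → 0 ≤ (W * (τ ⊗ₖ ω)).trace.re) {τ : Matrix A A ℂ}
    {ω : Matrix B B ℂ} (hτ : τ.PosSemidef) (hω : ω.PosSemidef) :
    0 ≤ (W * (τ ⊗ₖ ω)).trace.re := by
  obtain rfl | ⟨t, τ', ht, hτ', rfl⟩ := eq_zero_or_exists_isState_of_posSemidef hτ
  · simp
  obtain rfl | ⟨s, ω', hs, hω', rfl⟩ := eq_zero_or_exists_isState_of_posSemidef hω
  · simp
  rw [Matrix.smul_kronecker, Matrix.kronecker_smul, Matrix.mul_smul, Matrix.mul_smul,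
    Matrix.trace_smul, Matrix.trace_smul, smul_eq_mul, smul_eq_mul, Complex.re_ofReal_mul,
    Complex.re_ofReal_mul]
  exact mul_nonneg ht.le (mul_nonneg hs.le (hW τ' ω' hτ' hω'))

theorem isEntanglementWitness_of_forall_product {W : Matrix (A × B) (A × B) ℂ}
    (hW : W.IsHermitian)
    (hprod : ∀ τ ω, IsState τ → IsState ω → 0 ≤ (W * (τ ⊗ₖ ω)).trace.re) :
    IsEntanglementWitness W := by
  refine ⟨hW, ?_⟩
  rintro _ - ⟨m, τ, ω, hτ, hω, rfl⟩
  rw [Finset.mul_sum, Matrix.trace_sum, Complex.re_sum]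
  exact Finset.sum_nonneg fun i _ => trace_mul_kronecker_nonneg_of_isState hprod (hτ i) (hω i)

theorem IsEntanglementWitness.smul {W : Matrix (A × B) (A × B) ℂ} (hW : IsEntanglementWitness W)
    {ε : ℝ} (hε : 0 ≤ ε) : IsEntanglementWitness ((ε : ℂ) • W) := by
  refine ⟨by simp [Matrix.IsHermitian, hW.1.eq], fun σ hσ hsep => ?_⟩
  rw [Matrix.smul_mul, Matrix.trace_smul, smul_eq_mul, Complex.re_ofReal_mul]
  exact mul_nonneg hε (hW.2 σ hσ hsep)

theorem IsEntangledState.exists_witness {ρ : Matrix (A × B) (A × B) ℂ}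
    (hρ : IsEntangledState ρ) : ∃ W, IsEntanglementWitness W ∧ (W * ρ).trace.re < 0 := by
  classical
  have : LocallyConvexSpace ℝ (Matrix (A × B) (A × B) ℂ) :=
    inferInstanceAs (LocallyConvexSpace ℝ (A × B → A × B → ℂ))
  obtain ⟨f, u, hfρ, hf⟩ := RCLike.geometric_hahn_banach_point_closed (𝕜 := ℂ)
    (convex_convexHull ℝ _) isClosed_productStateHull
    fun h => hρ.2 (isSeparableOperator_of_mem_productStateHull h)
  obtain ⟨M, hM, hMf⟩ := exists_isHermitian_forall_trace_mul_re_eq f.toLinearMap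
  have hshift : ∀ X : Matrix (A × B) (A × B) ℂ, IsState X →
      ((M - (u : ℂ) • 1) * X).trace.re = (f X).re - u := fun X hX => by
    simp [Matrix.sub_mul, hX.2, hMf X hX.1.1]
  have hu : ((u : ℂ) • (1 : Matrix (A × B) (A × B) ℂ)).IsHermitian := by simp [Matrix.IsHermitian]
  refine ⟨M - (u : ℂ) • 1, isEntanglementWitness_of_forall_product (hM.sub hu)
    fun τ ω hτ hω => ?_, ?_⟩
  · have hτω : IsState (τ ⊗ₖ ω) :=
      ⟨hτ.1.kronecker hω.1, by rw [Matrix.trace_kronecker, hτ.2, hω.2, one_mul]⟩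
    rw [hshift _ hτω]
    exact sub_nonneg.mpr (hf _ (kronecker_mem_productStateHull hτ hω)).le
  · rw [hshift ρ hρ.1]
    exact sub_neg.mpr hfρ

end Witness

/-! ### The identity is interior to the separable cone -/

/-- `X` dominates a multiple of the identity in the order given by the cone of separable
operators. -/
def IsSeparablyBoundedBelow {A B : Type*} [DecidableEq A] [DecidableEq B]
    (X : Matrix (A × B) (A × B) ℂ) : Prop :=
  ∃ c : ℝ, IsSeparableOperator ((c : ℂ) • (1 : Matrix (A × B) (A × B) ℂ) + X)

theorem eq_sum_single_kronecker {A B R : Type*} [Fintype A] [DecidableEq A] [Semiring R]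
    (X : Matrix (A × B) (A × B) R) :
    X = ∑ i, ∑ j, Matrix.single i j (1 : R) ⊗ₖ (Matrix.of fun k l => X (i, k) (j, l)) := by
  ext ⟨i, k⟩ ⟨j, l⟩
  simp [Matrix.sum_apply, Matrix.single_apply, ite_and]

section Interior

open scoped ComplexStarModule

variable {A B : Type*}

theorem realPart_kronecker (P : Matrix A A ℂ) (Q : Matrix B B ℂ) :
    (ℜ (P ⊗ₖ Q) : Matrix (A × B) (A × B) ℂ) =
      (ℜ P : Matrix A A ℂ) ⊗ₖ (ℜ Q : Matrix B B ℂ) +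
        ((-ℑ P : selfAdjoint _) : Matrix A A ℂ) ⊗ₖ (ℑ Q : Matrix B B ℂ) := by
  ext ⟨i, k⟩ ⟨j, l⟩
  simp only [realPart_apply_coe, imaginaryPart_apply_coe, Matrix.star_eq_conjTranspose,
    NegMemClass.coe_neg, Matrix.neg_apply, Matrix.add_apply, Matrix.sub_apply, Matrix.smul_apply,
    Matrix.kroneckerMap_apply, Matrix.conjTranspose_apply, star_mul', RCLike.star_def,
    Complex.real_smul, Complex.ofReal_inv, Complex.ofReal_ofNat, smul_eq_mul]
  linear_combination (1 / 4) * (P i j - starRingEnd ℂ (P j i)) *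
    (Q k l - starRingEnd ℂ (Q l k)) * Complex.I_mul_I

variable [DecidableEq A] [DecidableEq B]

theorem IsSeparablyBoundedBelow.zero :
    IsSeparablyBoundedBelow (0 : Matrix (A × B) (A × B) ℂ) :=
  ⟨0, by simpa using IsSeparableOperator.zero⟩

theorem IsSeparablyBoundedBelow.add {X Y : Matrix (A × B) (A × B) ℂ}
    (hX : IsSeparablyBoundedBelow X) (hY : IsSeparablyBoundedBelow Y) :
    IsSeparablyBoundedBelow (X + Y) := by
  obtain ⟨c, hc⟩ := hX
  obtain ⟨d, hd⟩ := hY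
  refine ⟨c + d, ?_⟩
  convert hc.add hd using 1
  push_cast
  module

open scoped Topology in
theorem IsSeparablyBoundedBelow.eventually_isSeparableOperator [Finite A] [Finite B]
    {X : Matrix (A × B) (A × B) ℂ} (hX : IsSeparablyBoundedBelow X) :
    ∀ᶠ ε : ℝ in 𝓝[>] 0, IsSeparableOperator (1 + (ε : ℂ) • X) := by
  obtain ⟨c, hc⟩ := hX
  have hsmall : ∀ᶠ ε : ℝ in 𝓝[>] 0, ε * c < 1 :=
    (Continuous.tendsto' (by fun_prop) 0 0 (zero_mul c)).eventually_lt_const zero_lt_one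
      |>.filter_mono nhdsWithin_le_nhds
  filter_upwards [hsmall, self_mem_nhdsWithin] with ε hεc hε
  have hslack : (0 : ℂ) ≤ ((1 - ε * c : ℝ) : ℂ) := by exact_mod_cast (sub_pos.mpr hεc).le
  convert (hc.smul (Complex.zero_le_real.mpr (le_of_lt hε))).add
    (IsSeparableOperator.one.smul hslack) using 1
  push_cast
  module

section Finite

variable [Finite A] [Finite B]

open scoped MatrixOrder Matrix.Norms.L2Operator in
theorem exists_posSemidef_smul_one_add_sub {H : Matrix A A ℂ} (hH : H.IsHermitian) :
    ∃ c : ℝ, ((c : ℂ) • (1 : Matrix A A ℂ) + H).PosSemidef ∧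
      ((c : ℂ) • (1 : Matrix A A ℂ) - H).PosSemidef := by
  cases nonempty_fintype A
  have hle := IsSelfAdjoint.le_algebraMap_norm_self (a := H) hH
  have hge := IsSelfAdjoint.neg_algebraMap_norm_le_self (a := H) hH
  rw [Algebra.algebraMap_eq_smul_one, ← Complex.coe_smul] at hle hge
  refine ⟨‖H‖, ?_, hle⟩
  rw [add_comm, ← sub_neg_eq_add]
  exact hge

theorem isSeparablyBoundedBelow_kronecker {H : Matrix A A ℂ} {K : Matrix B B ℂ}
    (hH : H.IsHermitian) (hK : K.IsHermitian) : IsSeparablyBoundedBelow (H ⊗ₖ K) := by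
  obtain ⟨c, hadd, hsub⟩ := exists_posSemidef_smul_one_add_sub hH
  obtain ⟨d, hadd', hsub'⟩ := exists_posSemidef_smul_one_add_sub hK
  refine ⟨c * d, ?_⟩
  convert ((IsSeparableOperator.kronecker hadd hadd').add (.kronecker hsub hsub')).smul
    (Complex.zero_le_real.mpr one_half_pos.le) using 1
  simp only [Matrix.add_kronecker, Matrix.kronecker_add, sub_eq_add_neg, ← neg_one_smul ℂ H,
    ← neg_one_smul ℂ K, Matrix.smul_kronecker, Matrix.kronecker_smul, Matrix.one_kronecker_one]
  push_cast
  module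

theorem isSeparablyBoundedBelow_realPart_kronecker (P : Matrix A A ℂ) (Q : Matrix B B ℂ) :
    IsSeparablyBoundedBelow (ℜ (P ⊗ₖ Q) : Matrix (A × B) (A × B) ℂ) := by
  rw [realPart_kronecker]
  exact (isSeparablyBoundedBelow_kronecker (ℜ P).2 (ℜ Q).2).add
    (isSeparablyBoundedBelow_kronecker (-ℑ P).2 (ℑ Q).2)

theorem isSeparablyBoundedBelow_of_isHermitian {X : Matrix (A × B) (A × B) ℂ}
    (hX : X.IsHermitian) : IsSeparablyBoundedBelow X := by
  cases nonempty_fintype A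
  rw [← IsSelfAdjoint.coe_realPart hX, eq_sum_single_kronecker X]
  simp only [map_sum, AddSubgroup.val_finsetSum]
  exact Finset.sum_induction _ _ (fun _ _ => .add) .zero fun i _ =>
    Finset.sum_induction _ _ (fun _ _ => .add) .zero fun j _ =>
      isSeparablyBoundedBelow_realPart_kronecker _ _

end Finite

open scoped Topology Matrix.Norms.Frobenius in
theorem IsEntangledState.exists_small_witness [Fintype A] [Fintype B]
    {ρ : Matrix (A × B) (A × B) ℂ} (hρ : IsEntangledState ρ) :
    ∃ W, IsEntanglementWitness W ∧ frobeniusNorm W ≤ 1 ∧ (W * ρ).trace.re < 0 ∧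
      IsSeparableOperator (1 + W) ∧ IsSeparableOperator (1 - W) := by
  obtain ⟨W, hW, hWρ⟩ := hρ.exists_witness
  have hnorm : ∀ᶠ ε : ℝ in 𝓝[>] 0, ‖(ε : ℂ) • W‖ < 1 :=
    (Continuous.tendsto' (by fun_prop) 0 0 (by simp)).eventually_lt_const zero_lt_one
      |>.filter_mono nhdsWithin_le_nhds
  obtain ⟨ε, hle, hadd, hsub, hε⟩ := (hnorm.and
    ((isSeparablyBoundedBelow_of_isHermitian hW.1).eventually_isSeparableOperator.and
      ((isSeparablyBoundedBelow_of_isHermitian hW.1.neg).eventually_isSeparableOperator.and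
        self_mem_nhdsWithin))).exists
  refine ⟨(ε : ℂ) • W, hW.smul (le_of_lt hε), hle.le, ?_, hadd, ?_⟩
  · rw [Matrix.smul_mul, Matrix.trace_smul, smul_eq_mul, Complex.re_ofReal_mul]
    exact mul_neg_of_pos_of_neg hε hWρ
  · rwa [sub_eq_add_neg, ← smul_neg]

end Interior

/-! ### Fidelity with the maximally entangled state -/

theorem phiPlus_apply (p q : Fin 2 × Fin 2) :
    phiPlus p q = if p.1 = p.2 ∧ q.1 = q.2 then 1 / 2 else 0 := by
  rw [← inv_sqrt_two_mul_self]
  by_cases hp : p.1 = p.2 <;> by_cases hq : q.1 = q.2 <;>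
    simp [phiPlus, Matrix.vecMulVec_apply, phiPlusVec, hp, hq]

theorem posSemidef_phiPlus : phiPlus.PosSemidef :=
  Matrix.posSemidef_vecMulVec_self_star _

theorem trace_phiPlus : phiPlus.trace = 1 := by
  rw [phiPlus, Matrix.trace_vecMulVec, dotProduct_comm, star_phiPlusVec_dotProduct]

theorem smul_one_add_smul_one_add_phiPlus_eq_bellMatrix (x y : ℝ) :
    (x : ℂ) • (1 : Matrix (Fin 2 × Fin 2) (Fin 2 × Fin 2) ℂ) +
      (y : ℂ) • (1 + (2 : ℂ) • phiPlus) = bellMatrix (x + 2 * y) (x + y) y 0 := by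
  ext ⟨i, j⟩ ⟨k, l⟩
  fin_cases i <;> fin_cases j <;> fin_cases k <;> fin_cases l <;>
    simp [phiPlus_apply, bellMatrix] <;> ring

theorem posSemidef_phase {x : ℂ} (hx : x * star x = 1) :
    (!![1, star x; x, 1] : Matrix (Fin 2) (Fin 2) ℂ).PosSemidef := by
  convert Matrix.posSemidef_vecMulVec_self_star ![1, x] using 1
  ext i j
  fin_cases i <;> fin_cases j <;> simp_all [Matrix.vecMulVec_apply]

theorem isSeparableOperator_phase_kronecker {x : ℂ} (hx : x * star x = 1) :
    IsSeparableOperator ((!![1, star x; x, 1] : Matrix (Fin 2) (Fin 2) ℂ) ⊗ₖ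
      (!![1, x; star x, 1] : Matrix (Fin 2) (Fin 2) ℂ)) :=
  .kronecker (posSemidef_phase hx)
    (by simpa using posSemidef_phase (x := star x) (by rw [star_star, mul_comm, hx]))

theorem isSeparableOperator_one_add_phiPlus :
    IsSeparableOperator (1 + (2 : ℂ) • phiPlus) := by
  have hbasis : ∀ i : Fin 2, (Matrix.single i i (1 : ℂ)).PosSemidef := fun i => by
    rw [← Matrix.diagonal_single]
    exact .diagonal (Pi.single_nonneg.mpr zero_le_one)
  -- Averaging over the phases `1, -1, i, -i` kills all off-diagonal entries but those of `2 φ₂⁺`.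
  have hphases := (((isSeparableOperator_phase_kronecker (x := 1) (by simp)).add
    (isSeparableOperator_phase_kronecker (x := -1) (by simp))).add
      ((isSeparableOperator_phase_kronecker (x := Complex.I) (by simp)).add
        (isSeparableOperator_phase_kronecker (x := -Complex.I) (by simp)))).smul
          (Complex.zero_le_real.mpr (show (0 : ℝ) ≤ 1 / 4 by norm_num))
  convert ((IsSeparableOperator.kronecker (hbasis 0) (hbasis 0)).add
    (.kronecker (hbasis 1) (hbasis 1))).add hphases using 1
  ext ⟨i, j⟩ ⟨k, l⟩
  fin_cases i <;> fin_cases j <;> fin_cases k <;> fin_cases l <;>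
    norm_num [phiPlus_apply, Matrix.one_apply, Matrix.single_apply]

-- The partial transpose of `1 - 2 φ₂⁺` is the projection onto the span of `|01⟩ - |10⟩`, rescaled.
theorem trace_sub_two_mul_trace_phiPlus_mul_kronecker (τ ω : Matrix (Fin 2) (Fin 2) ℂ) :
    (τ ⊗ₖ ω).trace - 2 * (phiPlus * (τ ⊗ₖ ω)).trace =
      sesqForm (τ ⊗ₖ ωᵀ) (Pi.single (0, 1) 1 - Pi.single (1, 0) 1)
        (Pi.single (0, 1) 1 - Pi.single (1, 0) 1) := by
  simp only [Matrix.trace, Matrix.diag_apply, Matrix.kroneckerMap_apply, Fintype.sum_prod_type,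
    Fin.sum_univ_two, Matrix.mul_apply, phiPlus_apply, one_div, ite_mul, zero_mul, and_true,
    zero_ne_one, and_false, ↓reduceIte, add_zero, one_ne_zero, zero_add, sesqForm_eq_sum,
    Pi.sub_apply, Pi.single_apply, star_sub, RCLike.star_def,
    MonoidWithZeroHom.map_ite_one_zero, Matrix.transpose_apply, Prod.mk.injEq, zero_sub, mul_neg,
    mul_ite, mul_one, mul_zero, sub_zero, neg_zero, neg_mul, one_mul, neg_neg]
  ring

theorem IsSeparableOperator.two_mul_trace_phiPlus_mul_le
    {Y : Matrix (Fin 2 × Fin 2) (Fin 2 × Fin 2) ℂ} (hY : IsSeparableOperator Y) :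
    2 * (phiPlus * Y).trace ≤ Y.trace := by
  obtain ⟨m, τ, ω, hτ, hω, rfl⟩ := hY
  rw [Finset.mul_sum, Matrix.trace_sum, Matrix.trace_sum, Finset.mul_sum]
  refine Finset.sum_le_sum fun i _ => sub_nonneg.mp ?_
  rw [trace_sub_two_mul_trace_phiPlus_mul_kronecker]
  exact sesqForm_self_nonneg ((hτ i).kronecker (hω i).transpose) _

/-! ### Measure-and-prepare maps -/

/-- The map `X ↦ Tr(P X) Q`: test the effect `P`, and prepare `Q` if the test succeeds. -/
def measurePrepare {A C : Type*} [Fintype A] (P : Matrix A A ℂ) (Q : Matrix C C ℂ) :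
    Matrix A A ℂ →ₗ[ℂ] Matrix C C ℂ where
  toFun X := (P * X).trace • Q
  map_add' X Y := by rw [Matrix.mul_add, Matrix.trace_add, add_smul]
  map_smul' c X := by
    rw [Matrix.mul_smul, Matrix.trace_smul, RingHom.id_apply, smul_smul, smul_eq_mul]

theorem IsCompletelyPositive.add {A C : Type*}
    {Λ Θ : Matrix A A ℂ →ₗ[ℂ] Matrix C C ℂ} (hΛ : IsCompletelyPositive Λ)
    (hΘ : IsCompletelyPositive Θ) : IsCompletelyPositive (Λ + Θ) :=
  fun k M hM => (hΛ k M hM).add (hΘ k M hM)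

section MeasurePrepare

variable {A C : Type*} [Fintype A]

theorem measurePrepare_apply (P : Matrix A A ℂ) (Q : Matrix C C ℂ) (X : Matrix A A ℂ) :
    measurePrepare P Q X = (P * X).trace • Q := rfl

theorem vecMulVec_mul_mul_conjTranspose (w : C → ℂ) (v : A → ℂ) (X : Matrix A A ℂ) :
    Matrix.vecMulVec w (star v) * X * (Matrix.vecMulVec w (star v))ᴴ =
      (Matrix.vecMulVec v (star v) * X).trace • Matrix.vecMulVec w (star w) := by
  rw [Matrix.conjTranspose_vecMulVec, star_star, Matrix.vecMulVec_mul,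
    Matrix.vecMulVec_mul_vecMulVec, Matrix.vecMulVec_mul, Matrix.trace_vecMulVec,
    dotProduct_comm v, Matrix.vecMulVec_smul]

theorem isCompletelyPositive_measurePrepare [Finite C] {P : Matrix A A ℂ} {Q : Matrix C C ℂ}
    (hP : P.PosSemidef) (hQ : Q.PosSemidef) : IsCompletelyPositive (measurePrepare P Q) := by
  obtain ⟨m, v, rfl⟩ := Matrix.posSemidef_iff_eq_sum_vecMulVec.mp hP
  obtain ⟨n, w, rfl⟩ := Matrix.posSemidef_iff_eq_sum_vecMulVec.mp hQ
  convert isCompletelyPositive_krausMap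
    (fun p : Fin m × Fin n => Matrix.vecMulVec (w p.2) (star (v p.1))) using 1
  ext1 X
  simp only [measurePrepare_apply, krausMap_apply, Fintype.sum_prod_type,
    vecMulVec_mul_mul_conjTranspose, Finset.sum_mul, Matrix.trace_sum, Finset.sum_smul,
    Finset.smul_sum]
  exact Finset.sum_comm

theorem dualMap_measurePrepare_add [Fintype C] [DecidableEq A] (P P' : Matrix A A ℂ)
    (Q Q' : Matrix C C ℂ) :
    dualMap (measurePrepare P Q + measurePrepare P' Q') =
      measurePrepare Q P + measurePrepare Q' P' := by
  refine (eq_dualMap _ _ fun X Y => ?_).symm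
  simp only [LinearMap.add_apply, measurePrepare_apply, Matrix.add_mul, Matrix.mul_add,
    Matrix.smul_mul, Matrix.mul_smul, Matrix.trace_add, Matrix.trace_smul, smul_eq_mul,
    Matrix.trace_mul_comm X, mul_comm]

end MeasurePrepare

theorem trace_mul_nonneg_of_posSemidef {A : Type*} [Fintype A] {P X : Matrix A A ℂ}
    (hP : P.PosSemidef) (hX : X.PosSemidef) : 0 ≤ (P * X).trace := by
  obtain ⟨m, v, rfl⟩ := Matrix.posSemidef_iff_eq_sum_vecMulVec.mp hX
  rw [Matrix.mul_sum, Matrix.trace_sum]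
  exact Finset.sum_nonneg fun i _ => by
    rw [← sesqForm_self_eq_trace]
    exact sesqForm_self_nonneg hP _

theorem trace_mul_im_eq_zero_of_isHermitian {A : Type*} [Fintype A] {P X : Matrix A A ℂ}
    (hP : P.IsHermitian) (hX : X.IsHermitian) : (P * X).trace.im = 0 := by
  rw [← Complex.conj_eq_iff_im, ← Complex.star_def, ← Matrix.trace_conjTranspose,
    Matrix.conjTranspose_mul, hP.eq, hX.eq, Matrix.trace_mul_comm]

theorem IsEntanglementWitness.trace_mul_nonneg {A B : Type*} [Fintype A] [Fintype B]
    {W σ : Matrix (A × B) (A × B) ℂ} (hW : IsEntanglementWitness W) (hσ : IsSeparableOperator σ) :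
    0 ≤ (W * σ).trace := by
  refine Complex.nonneg_iff.mpr
    ⟨?_, (trace_mul_im_eq_zero_of_isHermitian hW.1 hσ.posSemidef.1).symm⟩
  obtain rfl | ⟨t, σ', ht, hσ', rfl⟩ := eq_zero_or_exists_isState_of_posSemidef hσ.posSemidef
  · simp
  · have hsep : IsSeparableOperator σ' := by
      have hscaled := hσ.smul (Complex.zero_le_real.mpr (inv_pos.mpr ht).le)
      rwa [smul_smul, ← Complex.ofReal_mul, inv_mul_cancel₀ ht.ne', Complex.ofReal_one,
        one_smul] at hscaled
    rw [Matrix.mul_smul, Matrix.trace_smul, smul_eq_mul, Complex.re_ofReal_mul]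
    exact mul_nonneg ht.le (hW.2 σ' hσ' hsep)

/-! ### The channel of a witness -/

section Channel

variable {A B : Type*} [DecidableEq A] [DecidableEq B] {W : Matrix (A × B) (A × B) ℂ}

/-- The effect `(W + 2) / 3`, whose outcome decides what `witnessChannel W` prepares. -/
def witnessTest (W : Matrix (A × B) (A × B) ℂ) : Matrix (A × B) (A × B) ℂ :=
  (1 / 3 : ℂ) • (W + (2 : ℂ) • 1)

theorem posSemidef_witnessTest [Finite A] [Finite B] (hW : IsSeparableOperator (1 + W)) :
    (witnessTest W).PosSemidef := by
  convert ((hW.add .one).smul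
    (Complex.zero_le_real.mpr (show (0 : ℝ) ≤ 1 / 3 by norm_num))).posSemidef using 1
  rw [witnessTest]
  push_cast
  module

theorem posSemidef_one_sub_witnessTest [Finite A] [Finite B]
    (hW : IsSeparableOperator (1 - W)) : (1 - witnessTest W).PosSemidef := by
  convert (hW.smul (Complex.zero_le_real.mpr (show (0 : ℝ) ≤ 1 / 3 by norm_num))).posSemidef
    using 1
  rw [witnessTest]
  push_cast
  module

variable [Fintype A] [Fintype B]

/-- The channel that tests `witnessTest W` and prepares the maximally mixed two-qubit state on
success, and `φ₂⁺` on failure. -/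
def witnessChannel (W : Matrix (A × B) (A × B) ℂ) :
    Matrix (A × B) (A × B) ℂ →ₗ[ℂ] Matrix (Fin 2 × Fin 2) (Fin 2 × Fin 2) ℂ :=
  measurePrepare (witnessTest W) ((1 / 4 : ℂ) • 1) + measurePrepare (1 - witnessTest W) phiPlus

theorem posSemidef_quarter_smul_one {C : Type*} [DecidableEq C] :
    ((1 / 4 : ℂ) • (1 : Matrix C C ℂ)).PosSemidef :=
  Matrix.PosSemidef.one.smul (by simp)

theorem isQuantumChannel_witnessChannel (hadd : IsSeparableOperator (1 + W))
    (hsub : IsSeparableOperator (1 - W)) : IsQuantumChannel (witnessChannel W) := by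
  refine ⟨(isCompletelyPositive_measurePrepare (posSemidef_witnessTest hadd)
    posSemidef_quarter_smul_one).add (isCompletelyPositive_measurePrepare
      (posSemidef_one_sub_witnessTest hsub) posSemidef_phiPlus), fun X => ?_⟩
  simp only [witnessChannel, LinearMap.add_apply, measurePrepare_apply, Matrix.trace_add,
    Matrix.trace_smul, trace_phiPlus, Matrix.trace_one, Matrix.sub_mul, Matrix.one_mul,
    Matrix.trace_sub, smul_eq_mul]
  norm_num

theorem isState_witnessChannel (hadd : IsSeparableOperator (1 + W))
    (hsub : IsSeparableOperator (1 - W)) {ρ : Matrix (A × B) (A × B) ℂ} (hρ : IsState ρ) :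
    IsState (witnessChannel W ρ) :=
  ⟨(posSemidef_quarter_smul_one.smul
      (trace_mul_nonneg_of_posSemidef (posSemidef_witnessTest hadd) hρ.1)).add
    (posSemidef_phiPlus.smul
      (trace_mul_nonneg_of_posSemidef (posSemidef_one_sub_witnessTest hsub) hρ.1)),
    ((isQuantumChannel_witnessChannel hadd hsub).2 ρ).trans hρ.2⟩

theorem witnessChannel_eq (W X : Matrix (A × B) (A × B) ℂ) :
    witnessChannel W X = ((1 / 4 : ℝ) * (W * X).trace) • 1 +
      ((1 / 6 : ℝ) * ((1 - W) * X).trace) • (1 + (2 : ℂ) • phiPlus) := by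
  simp only [witnessChannel, witnessTest, LinearMap.add_apply, measurePrepare_apply,
    Matrix.sub_mul, Matrix.add_mul, Matrix.smul_mul, Matrix.one_mul, Matrix.trace_sub,
    Matrix.trace_add, Matrix.trace_smul, smul_eq_mul]
  push_cast
  module

theorem dualMap_witnessChannel_eq (W : Matrix (A × B) (A × B) ℂ)
    (Y : Matrix (Fin 2 × Fin 2) (Fin 2 × Fin 2) ℂ) :
    dualMap (witnessChannel W) Y =
      ((1 / 12 : ℝ) * (Y.trace - 2 * (phiPlus * Y).trace)) • (1 + W + 1) +
        ((1 / 6 : ℝ) * (phiPlus * Y).trace) • (1 - W + (3 : ℝ) • 1) := by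
  rw [witnessChannel, dualMap_measurePrepare_add]
  simp only [witnessTest, LinearMap.add_apply, measurePrepare_apply, Matrix.smul_mul,
    Matrix.one_mul, Matrix.trace_smul, smul_eq_mul]
  push_cast
  module

theorem isDuallyNonEntangling_witnessChannel (hW : IsEntanglementWitness W)
    (hadd : IsSeparableOperator (1 + W)) (hsub : IsSeparableOperator (1 - W)) :
    IsDuallyNonEntangling (witnessChannel W) := by
  have hnonneg : ∀ {r : ℝ} {z : ℂ}, 0 ≤ r → 0 ≤ z → 0 ≤ (r : ℂ) * z := fun hr hz =>
    mul_nonneg (Complex.zero_le_real.mpr hr) hz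
  refine ⟨⟨(isQuantumChannel_witnessChannel hadd hsub).1, fun σ hσ => ?_⟩, ?_, fun Y hY => ?_⟩
  · rw [witnessChannel_eq]
    exact (IsSeparableOperator.one.smul (hnonneg (by norm_num) (hW.trace_mul_nonneg hσ))).add
      (isSeparableOperator_one_add_phiPlus.smul (hnonneg (by norm_num)
        (trace_mul_nonneg_of_posSemidef hsub.posSemidef hσ.posSemidef)))
  · rw [witnessChannel, dualMap_measurePrepare_add]
    exact (isCompletelyPositive_measurePrepare posSemidef_quarter_smul_one
      (posSemidef_witnessTest hadd)).add (isCompletelyPositive_measurePrepare posSemidef_phiPlus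
        (posSemidef_one_sub_witnessTest hsub))
  · rw [dualMap_witnessChannel_eq]
    exact ((hadd.add .one).smul (hnonneg (by norm_num)
      (sub_nonneg.mpr hY.two_mul_trace_phiPlus_mul_le))).add
        ((hsub.add (IsSeparableOperator.one.smul (Complex.zero_le_real.mpr zero_le_three))).smul
          (hnonneg (by norm_num)
            (trace_mul_nonneg_of_posSemidef posSemidef_phiPlus hY.posSemidef)))

theorem witnessChannel_eq_bellMatrix (hW : W.IsHermitian) {ρ : Matrix (A × B) (A × B) ℂ}
    (hρ : IsState ρ) :
    witnessChannel W ρ = bellMatrix ((4 - (W * ρ).trace.re) / 12) (((W * ρ).trace.re + 2) / 12)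
      ((1 - (W * ρ).trace.re) / 6) 0 := by
  have hreal : (W * ρ).trace = (((W * ρ).trace.re : ℝ) : ℂ) :=
    Complex.ext rfl (trace_mul_im_eq_zero_of_isHermitian hW hρ.1.1)
  have htrace : ((1 - W) * ρ).trace = ((1 - (W * ρ).trace.re : ℝ) : ℂ) := by
    rw [Matrix.sub_mul, Matrix.trace_sub, Matrix.one_mul, hρ.2, hreal]
    simp
  rw [witnessChannel_eq, htrace, hreal, ← Complex.ofReal_mul, ← Complex.ofReal_mul,
    smul_one_add_smul_one_add_phiPlus_eq_bellMatrix, Complex.ofReal_re]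
  congr 1 <;> ring

theorem neg_one_le_trace_mul_re (hadd : IsSeparableOperator (1 + W))
    {ρ : Matrix (A × B) (A × B) ℂ} (hρ : IsState ρ) : -1 ≤ (W * ρ).trace.re := by
  have hnonneg := (Complex.nonneg_iff.mp (trace_mul_nonneg_of_posSemidef hadd.posSemidef hρ.1)).1
  rw [Matrix.add_mul, Matrix.trace_add, Matrix.one_mul, hρ.2, Complex.add_re,
    Complex.one_re] at hnonneg
  linarith

theorem fidelity_witnessChannel (hW : W.IsHermitian) {ρ : Matrix (A × B) (A × B) ℂ}
    (hρ : IsState ρ) :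
    (witnessChannel W ρ * phiPlus).trace.re = 1 / 2 - (W * ρ).trace.re / 4 := by
  rw [phiPlus, ← sesqForm_self_eq_trace, witnessChannel_eq_bellMatrix hW hρ,
    sesqForm_bellMatrix_phiPlusVec, Complex.ofReal_re]
  ring

theorem isLOCCDistillable_witnessChannel (hW : W.IsHermitian)
    (hadd : IsSeparableOperator (1 + W)) (hsub : IsSeparableOperator (1 - W))
    {ρ : Matrix (A × B) (A × B) ℂ} (hρ : IsState ρ) (hWρ : (W * ρ).trace.re < 0) :
    IsLOCCDistillable (witnessChannel W ρ) := by
  have hlower := neg_one_le_trace_mul_re hadd hρ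
  have hstate := isState_witnessChannel hadd hsub hρ
  rw [witnessChannel_eq_bellMatrix hW hρ] at hstate ⊢
  exact isLOCCDistillable_bellMatrix (by linarith) (by linarith) (by linarith) hstate

end Channel

end

theorem mainTheorem2 {A B : Type*} [Fintype A] [DecidableEq A] [Fintype B] [DecidableEq B]
    (ρ : Matrix (A × B) (A × B) ℂ) (hρ : IsEntangledState ρ) :
    ∃ Λ : Matrix (A × B) (A × B) ℂ →ₗ[ℂ] Matrix (Fin 2 × Fin 2) (Fin 2 × Fin 2) ℂ,
      IsQuantumChannel Λ ∧ IsDuallyNonEntangling Λ ∧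
      1 / 2 < (Λ ρ * phiPlus).trace.re ∧
      IsLOCCDistillable (Λ ρ) ∧
      ∃ W : Matrix (A × B) (A × B) ℂ,
        IsEntanglementWitness W ∧ frobeniusNorm W ≤ 1 ∧ (W * ρ).trace.re < 0 ∧
        ∀ X, Λ X =
          (((1 / 3 : ℂ) • (W + (2 : ℂ) • 1)) * X).trace •
              ((1 / 4 : ℂ) • (1 : Matrix (Fin 2 × Fin 2) (Fin 2 × Fin 2) ℂ)) +
            ((1 - (1 / 3 : ℂ) • (W + (2 : ℂ) • 1)) * X).trace • phiPlus := by
  obtain ⟨W, hW, hnorm, hWρ, hadd, hsub⟩ := hρ.exists_small_witness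
  refine ⟨witnessChannel W, isQuantumChannel_witnessChannel hadd hsub,
    isDuallyNonEntangling_witnessChannel hW hadd hsub, ?_,
    isLOCCDistillable_witnessChannel hW.1 hadd hsub hρ.1 hWρ, W, hW, hnorm, hWρ, fun _ => rfl⟩
  rw [fidelity_witnessChannel hW.1 hρ.1]
  linarith
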